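/- There exist absolute constants $c>0$ and $k\in\mathbb N$ such that the following holds. Let $f:\mathbb R^d\to\mathbb R$ be convex and $\beta$-smooth (differentiable with $\|\nabla f(x)-\nabla f(y)\|\le\beta\|x-y\|$ for all $x,y$, in the Euclidean norm; $\beta\ge 0$), with a minimizer $w^\star$ and $f^\star=f(w^\star)$. Let $g$ be an unbiased stochastic gradient oracle: a query at $w\in\mathbb R^d$ returns a random vector $g(w)$ whose law depends only on $w$ (through a Markov kernel), with $\mathbb E[g(w)]=\nabla f(w)$. Assume that its noise is sub-Gaussian with affine variance, i.e. for some $\sigma_0,\sigma_1\ge 0$, all $w$ and all $t>0$, $$\Pr\big(\|g(w)-\mathbb E[g(w)]\|\ge t\big)\le 2\exp\!\Big(-\frac{t^2}{\sigma_0^2+\sigma_1^2\|\mathbb E[g(w)]\|^2}\Big),$$ where the right-hand side is read as $0$ if the denominator is $0$. For $T\ge 1$, $\eta,\gamma>0$ and an arbitrary $w_1\in\mathbb R^d$, run adaptive SGD: $$w_{t+1}=w_t-\eta_t g_t,\qquad \eta_t=\frac{\eta}{\sqrt{\gamma^2+\sum_{s=1}^t\|g_s\|^2}},\qquad 1\le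 t\le T,$$ where $g_t$ is the answer of the oracle to the query $w_t$, i.e. conditionally on $g_1,\dots,g_{t-1}$ it has the law of $g(w)$ at $w=w_t$. Let $\delta\in(0,1/4)$, let $\log$ be the base-2 logarithm, and put $\Delta_1=f(w_1)-f^\star$, $d_1=\|w_1-w^\star\|$, $$L=\log\!\Big(\frac T\delta\Big(1+\sigma_1^2+\frac{\sigma_0^2+\eta^2\beta^2+\beta\Delta_1}{\gamma^2}\Big)\Big),\qquad F=c\,L^k\big(\Delta_1+\eta\sigma_0+\eta^2\beta\sigma_1^2+\eta^2\beta\big),$$ and let $D\ge 0$ be given by $$D^2=c\,L^k\Big(d_1^2+\eta^2\big(1+\sigma_1^2+\gamma^{-2}(\sigma_0^2+\beta\sigma_1^2F)+\gamma^{-4}(\sigma_0^4+\beta^2\sigma_1^4F^2)\big)\Big).$$ Then, with probability at least $1-2\delta$, both of the following hold: (i) $$f\Big(\frac1T\sum_{t=1}^Tw_t\Big)-f^\star\le c\Big(\frac{D^2}{\eta}+\eta+D\sqrt{\log\tfrac1\delta}\Big)\frac{\sigma_0\sqrt{\log\frac T\delta}}{\sqrt T}+c\Big(\frac{\gamma d_1^2}{\eta}+\beta\big(1+\sigma_1^2\log\tfrac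 T\delta\big)\Big(\frac{D^2}{\eta}+\eta\Big)^2+\beta\sigma_1^2D^2\log\tfrac1\delta\log\tfrac T\delta\Big)\frac1T;$$ (ii) $\|w_t-w^\star\|\le D$ for all $1\le t\le T+1$. -/

import Mathlib

open MeasureTheory ProbabilityTheory

noncomputable section

/-- `d`-dimensional Euclidean space with the `ℓ₂` norm. -/
abbrev Vec (d : ℕ) : Type := EuclideanSpace ℝ (Fin d)

/-- `f` is `β`-smooth: differentiable with a `β`-Lipschitz gradient. -/
def IsSmoothWith {d : ℕ} (β : ℝ) (f : Vec d → ℝ) : Prop :=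
  Differentiable ℝ f ∧ ∀ x y : Vec d, ‖gradient f x - gradient f y‖ ≤ β * ‖x - y‖

/-- A stochastic first-order oracle is a Markov kernel `κ`: a query at `w` returns a random vector
`g(w)` with law `κ w`. It is a gradient oracle for `f` if `g(w)` has a finite mean equal to
`∇ f(w)`, for every `w`. -/
def IsGradientOracle {d : ℕ} (f : Vec d → ℝ) (κ : Kernel (Vec d) (Vec d)) : Prop :=
  ∀ w : Vec d, Integrable (fun x => x) (κ w) ∧ ∫ x, x ∂(κ w) = gradient f w

/-- Sub-Gaussian noise with affine variance: with `v = σ₀² + σ₁² ‖E[g(w)]‖²`, for every `t > 0`,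
`Pr(‖g(w) - E[g(w)]‖ ≥ t) ≤ 2 exp(-t² / v)`.
When `v = 0` the right-hand side is read as its limit `0` (there is no noise at `w`). -/
def IsSubGaussianAffine {d : ℕ} (σ₀ σ₁ : ℝ) (κ : Kernel (Vec d) (Vec d)) : Prop :=
  ∀ w : Vec d, ∀ t : ℝ, 0 < t →
    (κ w).real {x | t ≤ ‖x - ∫ y, y ∂(κ w)‖} ≤
      if σ₀ ^ 2 + σ₁ ^ 2 * ‖∫ y, y ∂(κ w)‖ ^ 2 = 0 then 0
      else 2 * Real.exp (-(t ^ 2 / (σ₀ ^ 2 + σ₁ ^ 2 * ‖∫ y, y ∂(κ w)‖ ^ 2)))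

/-- The iterates of adaptive SGD with parameters `η, γ`, started at `w₁` and fed with the stochastic
gradients `g`. Times are shifted by one: `adaSGD η γ w₁ g t` is the iterate `w_{t+1}` and `g t` is
the stochastic gradient `g_{t+1}`, so that the iterate at `0` is the starting point and
`w_{t+1} = w_t - η_t g_t` with `η_t = η / √(γ² + ∑_{s ≤ t} ‖g_s‖²)`. -/
def adaSGD {d : ℕ} (η γ : ℝ) (w₁ : Vec d) (g : ℕ → Vec d) : ℕ → Vec d
  | 0 => w₁
  | t + 1 => adaSGD η γ w₁ g t -
      (η / Real.sqrt (γ ^ 2 + ∑ s ∈ Finset.range (t + 1), ‖g s‖ ^ 2)) • g t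

/-- The σ-algebra generated by the stochastic gradients queried before step `t`. -/
abbrev pastSigma {Ω : Type*} {d : ℕ} (g : ℕ → Ω → Vec d) (t : ℕ) : MeasurableSpace Ω :=
  ⨆ s : ℕ, ⨆ _ : s < t, MeasurableSpace.comap (g s) inferInstance

/-- The random vectors `g 0, …, g (T - 1)` are the stochastic gradients observed in a `T`-step run of
adaptive SGD with the oracle `κ`: at every step, conditionally on the stochastic gradients queried
so far, the new stochastic gradient has the law `κ w` of a query at the current iterate `w`. -/
structure IsAdaSGDRun {Ω : Type*} [MeasurableSpace Ω] {d : ℕ} (μ : Measure Ω)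
    (κ : Kernel (Vec d) (Vec d)) (η γ : ℝ) (w₁ : Vec d) (T : ℕ) (g : ℕ → Ω → Vec d) : Prop where
  measurable : ∀ t < T, Measurable (g t)
  condLaw : ∀ t < T, ∀ B : Set (Vec d), MeasurableSet B →
    μ[(g t ⁻¹' B).indicator (fun _ => (1 : ℝ)) | pastSigma g t] =ᵐ[μ]
      fun ω => (κ (adaSGD η γ w₁ (fun s => g s ω) t)).real B

/-- The logarithmic quantity whose powers are hidden by the `Õ` notation; `Δ₁ = f(w₁) - f⋆`. -/
def logFactor (β σ₀ σ₁ η γ δ Δ₁ : ℝ) (T : ℕ) : ℝ :=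
  Real.logb 2 ((T / δ) * (1 + σ₁ ^ 2 + (σ₀ ^ 2 + η ^ 2 * β ^ 2 + β * Δ₁) / γ ^ 2))

/-- The quantity `F = Õ(Δ₁ + η σ₀ + η² β σ₁² + η² β)`, with constant `c` and `k`-th power of the
logarithmic factor `L`. -/
def gapBound (c : ℝ) (k : ℕ) (L β σ₀ σ₁ η Δ₁ : ℝ) : ℝ :=
  c * L ^ k * (Δ₁ + η * σ₀ + η ^ 2 * β * σ₁ ^ 2 + η ^ 2 * β)

/-- The quantity
`D² = Õ(d₁² + η² (1 + σ₁² + γ⁻² (σ₀² + β σ₁² F) + γ⁻⁴ (σ₀⁴ + β² σ₁⁴ F²)))`,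
with constant `c` and `k`-th power of the logarithmic factor `L`. -/
def distSqBound (c : ℝ) (k : ℕ) (L β σ₀ σ₁ η γ d₁ F : ℝ) : ℝ :=
  c * L ^ k * (d₁ ^ 2 + η ^ 2 * (1 + σ₁ ^ 2 + (σ₀ ^ 2 + β * σ₁ ^ 2 * F) / γ ^ 2
    + (σ₀ ^ 4 + β ^ 2 * σ₁ ^ 4 * F ^ 2) / γ ^ 4))

end

/-! Write ξ_t = g_t - ∇f(w_t) for the noise and S_t = γ² + ∑_{s<t} ‖g_s‖² (`sqSum`). The proof is
deterministic on a good event: for Λ = 4 log(T/δ), every ‖ξ_t‖² is at most Λ(σ₀² + σ₁²‖∇f(w_t)‖²),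
and four families of sums satisfy ∑⟨u_t, ξ_t⟩ ≤ (1/B) ∑⟨u_t, ξ_t⟩² + BΛ with u_t depending only on
the past.

These self-normalized bounds come from exp(z - z²) ≤ 1 + z for z ≥ -1/2: after truncating large
noise and scaling by B, the increments Z satisfy E exp(Z - Z²) ≤ 1 + (3/2)e^{-Λ} conditionally on
the past, so the exponential of the partial sums has mean at most 3 and Markov's inequality applies
(`IsAdaSGDRun.exists_measure_le_forall_sum_inner_le`). In each use the quadratic term is absorbed or
bounded by a sum already controlled.

The main obstacle is that η_t depends on g_t. It is replaced by a step that is known before g_t is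
drawn, and the error is paid for with ∑ ‖g_t‖²/S_{t+1} ≤ log(S_T/γ²) ≤ 7L; the last inequality holds
because one step moves the iterate by at most η, so gradients grow at most linearly in time.

The bounds are obtained in a chain. The descent inequality keeps f(w_t) - f⋆ below F
(`sub_le_gapBound_of_martingale`). Hence the noise is bounded, ∑ ‖ξ_t‖²/(S_t + ‖∇f(w_t)‖²) is
logarithmic up to a factor R, and the iterates stay within a radius E of the minimizer
(`norm_sub_le_of_martingale`). The regret bound of adaptive gradient descent and the self-bounding
inequality ‖∇f‖² ≤ 2β(f - f⋆) then bound the sum of the gaps (`sum_gap_le_of_martingale`), and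
convexity passes to the average. The apparent circularity, that martingale bounds need the bounds
being proved, is resolved by switching u_t off once a bound fails and by strong induction on time.
-/

open scoped InnerProductSpace

/-! ### Smooth and convex functions. -/

section Smooth

variable {d : ℕ} {β : ℝ} {f : Vec d → ℝ}

lemma hasDerivAt_comp_line (hf : Differentiable ℝ f) (x v : Vec d) (s : ℝ) :
    HasDerivAt (fun s : ℝ => f (x + s • v)) ⟪gradient f (x + s • v), v⟫_ℝ s := by
  have h1 : HasFDerivAt f (fderiv ℝ f (x + s • v)) (x + s • v) := (hf _).hasFDerivAt
  have h2 : HasDerivAt (fun s : ℝ => x + s • v) v s := by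
    simpa using ((hasDerivAt_id s).smul_const v).const_add x
  have h3 := h1.comp_hasDerivAt s h2
  rw [inner_gradient_left]
  exact h3

lemma IsSmoothWith.le_quadratic (hf : IsSmoothWith β f) (x y : Vec d) :
    f y ≤ f x + ⟪gradient f x, y - x⟫_ℝ + β / 2 * ‖y - x‖ ^ 2 := by
  set v := y - x with hv
  have hd : ∀ s : ℝ, HasDerivAt
      (fun s : ℝ => f (x + s • v) - s * ⟪gradient f x, v⟫_ℝ - β / 2 * ‖v‖ ^ 2 * s ^ 2)
      (⟪gradient f (x + s • v), v⟫_ℝ - ⟪gradient f x, v⟫_ℝ - β / 2 * ‖v‖ ^ 2 * (2 * s)) s := by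
    intro s
    have h1 := hasDerivAt_comp_line hf.1 x v s
    have h2 : HasDerivAt (fun s : ℝ => s * ⟪gradient f x, v⟫_ℝ) (⟪gradient f x, v⟫_ℝ) s := by
      simpa using (hasDerivAt_id s).mul_const (⟪gradient f x, v⟫_ℝ)
    have h3 : HasDerivAt (fun s : ℝ => β / 2 * ‖v‖ ^ 2 * s ^ 2) (β / 2 * ‖v‖ ^ 2 * (2 * s)) s := by
      simpa using (hasDerivAt_pow 2 s).const_mul (β / 2 * ‖v‖ ^ 2)
    exact (h1.sub h2).sub h3
  have hanti := antitoneOn_of_deriv_nonpos (convex_Icc (0 : ℝ) 1)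
    (fun s _ => (hd s).continuousAt.continuousWithinAt)
    (fun s _ => (hd s).differentiableAt.differentiableWithinAt) (by
      intro s hs
      rw [interior_Icc] at hs
      rw [(hd s).deriv, ← inner_sub_left]
      have h1 := real_inner_le_norm (gradient f (x + s • v) - gradient f x) v
      have h2 := hf.2 (x + s • v) x
      have h3 : ‖x + s • v - x‖ = s * ‖v‖ := by
        rw [add_sub_cancel_left, norm_smul, Real.norm_of_nonneg hs.1.le]
      rw [h3] at h2
      nlinarith [norm_nonneg v, mul_le_mul_of_nonneg_right h2 (norm_nonneg v)])
  have := hanti (Set.left_mem_Icc.2 zero_le_one) (Set.right_mem_Icc.2 zero_le_one) zero_le_one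
  have hxy : x + v = y := by simp [hv]
  simp only [one_smul, zero_smul, add_zero, one_mul, zero_mul, one_pow, mul_one, sub_zero, hxy,
    ne_eq, OfNat.ofNat_ne_zero, not_false_eq_true, zero_pow, mul_zero] at this
  linarith

lemma gradient_eq_zero_of_forall_le {x : Vec d} (h : ∀ w, f x ≤ f w) : gradient f x = 0 := by
  have : IsLocalMin f x := Filter.Eventually.of_forall h
  rw [gradient, this.fderiv_eq_zero, map_zero]

/-- Self-bounding: a gradient step of length 1/β decreases f by ‖∇f‖²/(2β), but not below the
minimum. For β = 0 the gradient is constant, hence zero. -/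
lemma IsSmoothWith.norm_gradient_sq_le (hβ : 0 ≤ β) (hf : IsSmoothWith β f) {x : Vec d}
    (hx : ∀ w, f x ≤ f w) (w : Vec d) : ‖gradient f w‖ ^ 2 ≤ 2 * β * (f w - f x) := by
  rcases hβ.eq_or_lt with rfl | hβ
  · have := hf.2 w x
    rw [gradient_eq_zero_of_forall_le hx, zero_mul, sub_zero] at this
    have h0 : ‖gradient f w‖ = 0 := le_antisymm this (norm_nonneg _)
    simp [h0]
  · have h1 := hf.le_quadratic w (w - β⁻¹ • gradient f w)
    have h2 := hx (w - β⁻¹ • gradient f w)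
    have h3 : w - β⁻¹ • gradient f w - w = -(β⁻¹ • gradient f w) := by abel
    rw [h3, inner_neg_right, inner_smul_right, real_inner_self_eq_norm_sq, norm_neg, norm_smul,
      Real.norm_of_nonneg (inv_nonneg.2 hβ.le)] at h1
    have h4 : β / 2 * (β⁻¹ * ‖gradient f w‖) ^ 2 = β⁻¹ * ‖gradient f w‖ ^ 2 / 2 := by
      field_simp
    have h5 : β⁻¹ * ‖gradient f w‖ ^ 2 ≤ 2 * (f w - f x) := by linarith
    calc ‖gradient f w‖ ^ 2 = β * (β⁻¹ * ‖gradient f w‖ ^ 2) := by field_simp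
      _ ≤ β * (2 * (f w - f x)) := by gcongr
      _ = _ := by ring

lemma IsSmoothWith.norm_gradient_le (hf : IsSmoothWith β f) {x : Vec d}
    (hx : ∀ w, f x ≤ f w) (w : Vec d) : ‖gradient f w‖ ≤ β * ‖w - x‖ := by
  simpa [gradient_eq_zero_of_forall_le hx] using hf.2 w x

lemma IsSmoothWith.continuous_gradient (hf : IsSmoothWith β f) : Continuous (gradient f) := by
  have : LipschitzWith (Real.toNNReal β) (gradient f) := by
    refine LipschitzWith.of_dist_le_mul fun x y => ?_
    rw [dist_eq_norm, dist_eq_norm]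
    exact (hf.2 x y).trans (by gcongr; exact Real.le_coe_toNNReal β)
  exact this.continuous

lemma sub_le_inner_gradient (hc : ConvexOn ℝ Set.univ f) (hf : Differentiable ℝ f)
    (x y : Vec d) : f x - f y ≤ ⟪gradient f x, x - y⟫_ℝ := by
  have h1 := hasDerivAt_comp_line hf x (y - x) 0
  have h2 : ConvexOn ℝ Set.univ (fun s : ℝ => f (x + s • (y - x))) := by
    refine ⟨convex_univ, fun s _ t _ a b ha hb hab => ?_⟩
    have h := hc.2 (Set.mem_univ (x + s • (y - x))) (Set.mem_univ (x + t • (y - x))) ha hb hab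
    have e : a • (x + s • (y - x)) + b • (x + t • (y - x)) =
        x + (a • s + b • t) • (y - x) := by
      obtain rfl : b = 1 - a := by linarith
      simp only [smul_eq_mul]
      module
    rwa [e] at h
  have h3 := h2.le_slope_of_hasDerivAt (Set.mem_univ 0) (Set.mem_univ 1) zero_lt_one h1
  simp only [slope_def_field, zero_smul, add_zero, one_smul, add_sub_cancel, sub_zero,
    div_one] at h3
  have h4 : ⟪gradient f x, x - y⟫_ℝ = - ⟪gradient f x, y - x⟫_ℝ := by
    rw [← inner_neg_right, neg_sub]
  linarith

end Smooth

/-- Replaces a moment generating function bound: the compensator is the realized z², so no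
conditional variance appears later. For z ≥ 0 the first-order lower bound of exp(z² - z) suffices,
for z ≤ 0 the second-order one. -/
lemma exp_sub_sq_le {z : ℝ} (hz : -(1 / 2) ≤ z) : Real.exp (z - z ^ 2) ≤ 1 + z := by
  have key : 1 ≤ (1 + z) * Real.exp (z ^ 2 - z) := by
    rcases le_total 0 z with h | h
    · have h1 := Real.add_one_le_exp (z ^ 2 - z)
      have h2 : 0 ≤ z ^ 3 := by positivity
      nlinarith [mul_le_mul_of_nonneg_left h1 (by linarith : 0 ≤ 1 + z)]
    · have h1 := Real.quadratic_le_exp_of_nonneg (x := z ^ 2 - z) (by nlinarith)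
      have h2 : 0 ≤ z ^ 2 * (1 + z - z ^ 2 + z ^ 3) := by
        apply mul_nonneg (sq_nonneg _)
        nlinarith [mul_nonneg (by linarith : 0 ≤ z + 1 / 2) (neg_nonneg.2 h), sq_nonneg z,
          mul_nonneg (mul_nonneg (by linarith : 0 ≤ z + 1 / 2) (neg_nonneg.2 h))
            (neg_nonneg.2 h)]
      nlinarith [mul_le_mul_of_nonneg_left h1 (by linarith : 0 ≤ 1 + z)]
  have e : Real.exp (z - z ^ 2) * Real.exp (z ^ 2 - z) = 1 := by
    rw [← Real.exp_add]; simp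
  have := Real.exp_pos (z ^ 2 - z)
  by_contra! hc
  nlinarith [mul_lt_mul_of_pos_right hc this]

/-! ### Exponential moment of one truncated noise increment. -/

section OneStep

variable {d : ℕ} {ν : Measure (Vec d)} {m : Vec d} {v Λ : ℝ}

lemma measure_norm_sub_pos_eq_zero [IsFiniteMeasure ν]
    (htail : ∀ t : ℝ, 0 < t → ν.real {x | t ≤ ‖x - m‖} ≤ 0) : ν {x | 0 < ‖x - m‖} = 0 := by
  have : {x : Vec d | 0 < ‖x - m‖} ⊆ ⋃ n : ℕ, {x | 1 / ((n : ℝ) + 1) ≤ ‖x - m‖} := by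
    intro x hx
    obtain ⟨n, hn⟩ := exists_nat_one_div_lt (show 0 < ‖x - m‖ from hx)
    exact Set.mem_iUnion.2 ⟨n, hn.le⟩
  refine measure_mono_null this (measure_iUnion_null fun n => ?_)
  have h := htail (1 / ((n : ℝ) + 1)) (by positivity)
  exact (measureReal_eq_zero_iff).1 (le_antisymm h measureReal_nonneg)

lemma measureReal_lt_norm_sub_sq_le [IsFiniteMeasure ν] (hv : 0 ≤ v) (hΛ : 0 < Λ)
    (htail : ∀ t : ℝ, 0 < t → ν.real {x | t ≤ ‖x - m‖} ≤
      if v = 0 then 0 else 2 * Real.exp (-(t ^ 2 / v))) :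
    ν.real {x | Λ * v < ‖x - m‖ ^ 2} ≤ 2 * Real.exp (-Λ) := by
  rcases hv.eq_or_lt with rfl | hv
  · have h := measure_norm_sub_pos_eq_zero (by simpa using htail)
    have : ν.real {x | Λ * 0 < ‖x - m‖ ^ 2} = 0 := by
      rw [measureReal_eq_zero_iff]
      refine measure_mono_null (fun x hx => ?_) h
      rw [Set.mem_ofPred_eq, mul_zero, sq_pos_iff] at hx
      exact (norm_nonneg _).lt_of_ne' hx
    rw [this]; positivity
  · have h := htail (√(Λ * v)) (Real.sqrt_pos.2 (by positivity))
    rw [if_neg hv.ne', Real.sq_sqrt (by positivity), mul_div_assoc, div_self hv.ne', mul_one] at h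
    refine (measureReal_mono (fun x hx => ?_)).trans h
    exact Real.sqrt_le_iff.2 ⟨norm_nonneg _, (show Λ * v < _ from hx).le⟩

/-- Controls the bias caused by truncation at a = √(Λv). On the tail, ‖x - m‖ ≤ a + (‖x - m‖ - a)⁺;
the first part costs a·2e^{-Λ}, the second is integrated by the layer-cake formula and costs
(v/a)e^{-Λ} ≤ a e^{-Λ}. -/
lemma integral_norm_sub_indicator_le [IsProbabilityMeasure ν] (hv : 0 ≤ v) (hΛ : 1 ≤ Λ)
    (hint : Integrable (fun x => x) ν)
    (htail : ∀ t : ℝ, 0 < t → ν.real {x | t ≤ ‖x - m‖} ≤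
      if v = 0 then 0 else 2 * Real.exp (-(t ^ 2 / v))) :
    ∫ x, {x | Λ * v < ‖x - m‖ ^ 2}.indicator (fun x => ‖x - m‖) x ∂ν
      ≤ 3 * √(Λ * v) * Real.exp (-Λ) := by
  have hΛ0 : 0 < Λ := by linarith
  have hX : Integrable (fun x => ‖x - m‖) ν := (hint.sub (integrable_const m)).norm
  have hS : MeasurableSet {x : Vec d | Λ * v < ‖x - m‖ ^ 2} :=
    measurableSet_lt measurable_const (by fun_prop)
  rcases hv.eq_or_lt with rfl | hv
  · have h := measure_norm_sub_pos_eq_zero (by simpa using htail)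
    rw [integral_eq_zero_of_ae]
    · simp
    · filter_upwards [measure_eq_zero_iff_ae_notMem.1 h] with x hx
      refine Set.indicator_of_notMem (fun h => hx ?_) _
      rw [Set.mem_ofPred_eq, mul_zero, sq_pos_iff] at h
      exact (norm_nonneg _).lt_of_ne' h
  set a := √(Λ * v) with ha
  have ha0 : 0 < a := Real.sqrt_pos.2 (by positivity)
  have ha2 : a ^ 2 = Λ * v := Real.sq_sqrt (by positivity)
  have hI : Integrable (fun x => max (‖x - m‖ - a) 0) ν := (hX.sub (integrable_const a)).pos_part
  have h1 : ∫ x, max (‖x - m‖ - a) 0 ∂ν ≤ a * Real.exp (-Λ) := by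
    rw [hI.integral_eq_integral_meas_le (Filter.Eventually.of_forall fun x => le_max_right _ _)]
    have hneg : -(2 * a / v) < 0 := by have := div_pos (mul_pos two_pos ha0) hv; linarith
    calc ∫ t in Set.Ioi 0, ν.real {x | t ≤ max (‖x - m‖ - a) 0}
        ≤ ∫ t in Set.Ioi 0, 2 * Real.exp (-Λ) * Real.exp (-(2 * a / v) * t) := by
          refine integral_mono_of_nonneg (Filter.Eventually.of_forall fun _ => measureReal_nonneg)
            ((integrableOn_exp_mul_Ioi hneg 0).const_mul _) ?_
          filter_upwards [ae_restrict_mem measurableSet_Ioi] with t ht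
          have ht : 0 < t := ht
          have h := htail (a + t) (by positivity)
          rw [if_neg hv.ne'] at h
          calc ν.real {x | t ≤ max (‖x - m‖ - a) 0} ≤ ν.real {x | a + t ≤ ‖x - m‖} := by
                refine measureReal_mono fun x hx => ?_
                rcases le_max_iff.1 (show t ≤ max (‖x - m‖ - a) 0 from hx) with h | h
                · show a + t ≤ ‖x - m‖
                  linarith
                · exact absurd h (not_le.2 ht)
            _ ≤ _ := h
            _ ≤ _ := by
              rw [mul_assoc, ← Real.exp_add]
              gcongr
              -- Dropping t²/v from the expanded square leaves an exponential in t with an explicit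
              -- integral.
              have e : (a + t) ^ 2 / v = Λ + 2 * a / v * t + t ^ 2 / v := by
                field_simp
                rw [add_sq, ha2]
                ring
              have : 0 ≤ t ^ 2 / v := by positivity
              rw [e]; linarith
      _ = 2 * Real.exp (-Λ) * (v / (2 * a)) := by
          rw [integral_const_mul, integral_exp_mul_Ioi hneg]
          simp
      _ = (v / a) * Real.exp (-Λ) := by field_simp
      _ ≤ _ := by
          gcongr
          rw [div_le_iff₀ ha0]
          nlinarith
  have h2 : ∫ x, {x | Λ * v < ‖x - m‖ ^ 2}.indicator (fun _ => a) x ∂ν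
      ≤ a * (2 * Real.exp (-Λ)) := by
    rw [integral_indicator hS, setIntegral_const, smul_eq_mul, mul_comm]
    gcongr
    exact measureReal_lt_norm_sub_sq_le hv.le hΛ0 htail
  calc _ ≤ ∫ x, ({x | Λ * v < ‖x - m‖ ^ 2}.indicator (fun _ => a) x + max (‖x - m‖ - a) 0) ∂ν := by
        refine integral_mono (hX.indicator hS) (((integrable_const a).indicator hS).add hI) fun x => ?_
        by_cases hx : x ∈ {x | Λ * v < ‖x - m‖ ^ 2}
        · simp only [Set.indicator_of_mem hx]
          linarith [le_max_left (‖x - m‖ - a) 0]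
        · simp [Set.indicator_of_notMem hx]
    _ ≤ a * (2 * Real.exp (-Λ)) + a * Real.exp (-Λ) := by
        rw [integral_add ((integrable_const a).indicator hS) hI]
        exact add_le_add h2 h1
    _ = _ := by ring

/-- The inner product of `u` with the noise `x - m`, set to `0` if the noise is too large. -/
noncomputable def truncInner (Λ v : ℝ) (u m x : Vec d) : ℝ :=
  if ‖x - m‖ ^ 2 ≤ Λ * v then ⟪u, x - m⟫_ℝ else 0

/-- The condition on u keeps the truncated product above -1/2, so exp(Z - Z²) ≤ 1 + Z. The full
inner product has mean zero; the truncated one differs from it by at most ‖u‖·‖x - m‖ on the tail,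
of mean at most (3/2)e^{-Λ}. -/
lemma lintegral_exp_truncInner_le [IsProbabilityMeasure ν] (hv : 0 ≤ v) (hΛ : 1 ≤ Λ)
    (hint : Integrable (fun x => x) ν) (hm : ∫ x, x ∂ν = m)
    (htail : ∀ t : ℝ, 0 < t → ν.real {x | t ≤ ‖x - m‖} ≤
      if v = 0 then 0 else 2 * Real.exp (-(t ^ 2 / v)))
    {u : Vec d} (hu : ‖u‖ * √(Λ * v) ≤ 1 / 2) :
    ∫⁻ x, ENNReal.ofReal (Real.exp (truncInner Λ v u m x - truncInner Λ v u m x ^ 2)) ∂ν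
      ≤ ENNReal.ofReal (1 + 3 / 2 * Real.exp (-Λ)) := by
  have hS : MeasurableSet {x : Vec d | Λ * v < ‖x - m‖ ^ 2} :=
    measurableSet_lt measurable_const (by fun_prop)
  have hc : Integrable (fun x => x - m) ν := hint.sub (integrable_const m)
  have hI : Integrable (fun x => ⟪u, x - m⟫_ℝ) ν := hc.const_inner u
  have hJ : Integrable ({x | Λ * v < ‖x - m‖ ^ 2}.indicator (fun x => ‖x - m‖)) ν :=
    hc.norm.indicator hS
  have hle : ∀ x, Real.exp (truncInner Λ v u m x - truncInner Λ v u m x ^ 2) ≤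
      1 + ⟪u, x - m⟫_ℝ + ‖u‖ * {x | Λ * v < ‖x - m‖ ^ 2}.indicator (fun x => ‖x - m‖) x := by
    intro x
    have habs := neg_le_of_abs_le (abs_real_inner_le_norm u (x - m))
    unfold truncInner
    split_ifs with h
    · rw [Set.indicator_of_notMem (by simpa using h), mul_zero, add_zero]
      refine exp_sub_sq_le ?_
      have : ‖u‖ * ‖x - m‖ ≤ ‖u‖ * √(Λ * v) := by
        gcongr
        exact Real.le_sqrt_of_sq_le h
      linarith
    · rw [Set.indicator_of_mem (by simpa using h)]
      simp only [ne_eq, OfNat.ofNat_ne_zero, not_false_eq_true, zero_pow, sub_zero, Real.exp_zero]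
      linarith
  have hK : Integrable (fun x => 1 + ⟪u, x - m⟫_ℝ +
      ‖u‖ * {x | Λ * v < ‖x - m‖ ^ 2}.indicator (fun x => ‖x - m‖) x) ν :=
    ((integrable_const 1).add hI).add (hJ.const_mul _)
  calc _ ≤ ∫⁻ x, ENNReal.ofReal (1 + ⟪u, x - m⟫_ℝ +
      ‖u‖ * {x | Λ * v < ‖x - m‖ ^ 2}.indicator (fun x => ‖x - m‖) x) ∂ν :=
        lintegral_mono fun x => ENNReal.ofReal_le_ofReal (hle x)
    _ = ENNReal.ofReal (∫ x, (1 + ⟪u, x - m⟫_ℝ +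
      ‖u‖ * {x | Λ * v < ‖x - m‖ ^ 2}.indicator (fun x => ‖x - m‖) x) ∂ν) :=
        (ofReal_integral_eq_lintegral_ofReal hK
          (Filter.Eventually.of_forall fun x => (Real.exp_pos _).le.trans (hle x))).symm
    _ ≤ _ := by
        apply ENNReal.ofReal_le_ofReal
        have h0 : ∫ x, ⟪u, x - m⟫_ℝ ∂ν = 0 := by
          rw [integral_inner hc, integral_sub hint (integrable_const m), hm]
          simp
        have h1 := integral_norm_sub_indicator_le hv hΛ hint htail
        have hI1 : Integrable (fun x => 1 + ⟪u, x - m⟫_ℝ) ν := (integrable_const 1).add hI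
        rw [integral_add hI1 (hJ.const_mul _), integral_add (integrable_const 1) hI, h0,
          integral_const_mul]
        have h2 : ‖u‖ * (3 * √(Λ * v) * Real.exp (-Λ)) ≤ 3 / 2 * Real.exp (-Λ) := by
          have := mul_le_mul_of_nonneg_right hu (Real.exp_pos (-Λ)).le
          linarith
        have h3 := mul_le_mul_of_nonneg_left h1 (norm_nonneg u)
        simp
        linarith

end OneStep

/-! ### From the conditional law to tail bounds along the trajectory. -/

section Trajectory

variable {Ω : Type*} {_ : MeasurableSpace Ω} {d : ℕ} {μ : Measure Ω} {f : Vec d → ℝ}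
  {κ : Kernel (Vec d) (Vec d)} {β σ₀ σ₁ η γ Λ : ℝ} {w₁ : Vec d} {T : ℕ} {g : ℕ → Ω → Vec d}

/-- The sequence `h` with all terms from time `t` on replaced by `0`. -/
def pastOf {d : ℕ} (t : ℕ) (h : ℕ → Vec d) : ℕ → Vec d := fun s => if s < t then h s else 0

lemma pastOf_apply {t s : ℕ} (hs : s < t) (h : ℕ → Vec d) : pastOf t h s = h s := if_pos hs

lemma pastOf_pastOf {t s : ℕ} (hs : s ≤ t) (h : ℕ → Vec d) : pastOf s (pastOf t h) = pastOf s h := by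
  ext1 r
  unfold pastOf
  split_ifs <;> first | rfl | omega

lemma adaSGD_congr {h h' : ℕ → Vec d} (t : ℕ) (hh : ∀ s < t, h s = h' s) :
    adaSGD η γ w₁ h t = adaSGD η γ w₁ h' t := by
  induction t with
  | zero => rfl
  | succ t ih =>
    simp only [adaSGD]
    rw [ih fun s hs => hh s (by omega), hh t (by omega),
      Finset.sum_congr rfl fun s hs => by rw [hh s (Finset.mem_range.1 hs)]]

lemma adaSGD_pastOf (t : ℕ) (h : ℕ → Vec d) :
    adaSGD η γ w₁ (pastOf t h) t = adaSGD η γ w₁ h t :=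
  adaSGD_congr t fun _ hs => pastOf_apply hs h

lemma measurable_adaSGD (η γ : ℝ) (w₁ : Vec d) (t : ℕ) :
    Measurable fun h : ℕ → Vec d => adaSGD η γ w₁ h t := by
  induction t with
  | zero => exact measurable_const
  | succ t ih =>
    simp only [adaSGD]
    refine ih.sub (Measurable.fun_smul ?_ (measurable_pi_apply t))
    refine measurable_const.div (Measurable.sqrt ?_)
    exact measurable_const.add
      (Finset.measurable_sum _ fun s _ => (measurable_pi_apply s).norm.pow_const 2)

lemma measurable_pastOf_pastSigma {Ω : Type*} {g : ℕ → Ω → Vec d} (t : ℕ) :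
    Measurable[pastSigma g t] fun ω => pastOf t fun s => g s ω := by
  refine @measurable_pi_lambda _ _ _ (pastSigma g t) _ _ fun s => ?_
  by_cases hs : s < t
  · simp only [pastOf, if_pos hs]
    exact Measurable.mono (comap_measurable (g s))
      (le_iSup₂_of_le s hs le_rfl) le_rfl
  · simp only [pastOf, if_neg hs]
    exact @measurable_const _ _ _ (pastSigma g t) _

lemma pastSigma_le {t : ℕ} (ht : t ≤ T) (hg : ∀ t < T, Measurable (g t)) :
    pastSigma g t ≤ ‹MeasurableSpace Ω› :=
  iSup₂_le fun s hs => (hg s (by omega)).comap_le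

/-- Integrating the conditional law over a past event identifies both measures on rectangles.
Afterwards conditional expectations are plain integrals against the kernel. Padding the past with
zeros keeps it in one fixed space for all t. -/
lemma IsAdaSGDRun.map_pastOf_eq_compProd [IsProbabilityMeasure μ] [IsMarkovKernel κ]
    (hrun : IsAdaSGDRun μ κ η γ w₁ T g) {t : ℕ} (ht : t < T) :
    μ.map (fun ω => (pastOf t (fun s => g s ω), g t ω)) =
      (μ.map fun ω => pastOf t fun s => g s ω) ⊗ₘ
        (κ.comap (fun h => adaSGD η γ w₁ h t) (measurable_adaSGD η γ w₁ t)) := by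
  have hm := pastSigma_le ht.le hrun.measurable
  have hH := (measurable_pastOf_pastSigma (g := g) t).mono hm le_rfl
  have hgt := hrun.measurable t ht
  have : IsProbabilityMeasure (μ.map fun ω => (pastOf t (fun s => g s ω), g t ω)) :=
    Measure.isProbabilityMeasure_map (hH.prodMk hgt).aemeasurable
  have : IsProbabilityMeasure (μ.map fun ω => pastOf t fun s => g s ω) :=
    Measure.isProbabilityMeasure_map hH.aemeasurable
  refine Measure.ext_prod fun {A B} hA hB => ?_
  have hκ : Measurable fun h : ℕ → Vec d => κ (adaSGD η γ w₁ h t) B :=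
    (κ.measurable_coe hB).comp (measurable_adaSGD η γ w₁ t)
  rw [Measure.compProd_apply_prod hA hB, Measure.map_apply (hH.prodMk hgt) (hA.prod hB)]
  simp only [Kernel.comap_apply]
  rw [setLIntegral_map hA hκ hH]
  simp only [adaSGD_pastOf]
  set S := (fun ω => pastOf t fun s => g s ω) ⁻¹' A with hS
  have hSm : MeasurableSet[pastSigma g t] S := measurable_pastOf_pastSigma t hA
  have h1 := setIntegral_condExp hm (μ := μ) (f := (g t ⁻¹' B).indicator (fun _ => (1 : ℝ)))
    ((integrable_const 1).indicator (hgt hB)) hSm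
  rw [setIntegral_congr_ae (hm _ hSm) ((hrun.condLaw t ht B hB).mono fun ω h _ => h),
    setIntegral_indicator (hgt hB), setIntegral_const, smul_eq_mul, mul_one] at h1
  have h2 : ∫⁻ ω in S, κ (adaSGD η γ w₁ (fun s => g s ω) t) B ∂μ =
      ENNReal.ofReal (∫ ω in S, (κ (adaSGD η γ w₁ (fun s => g s ω) t)).real B ∂μ) := by
    have hmeas : Measurable fun ω => κ (adaSGD η γ w₁ (fun s => g s ω) t) B := by
      have := hκ.comp hH
      simpa only [Function.comp_def, adaSGD_pastOf] using this
    rw [ofReal_integral_eq_lintegral_ofReal]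
    · exact lintegral_congr fun ω => (ofReal_measureReal).symm
    · refine Integrable.of_bound hmeas.ennreal_toReal.aestronglyMeasurable 1
        (Filter.Eventually.of_forall fun ω => ?_)
      rw [Real.norm_of_nonneg measureReal_nonneg]
      exact measureReal_le_one
    · exact Filter.Eventually.of_forall fun ω => measureReal_nonneg
  rw [h2, h1, ofReal_measureReal]
  rfl

lemma IsAdaSGDRun.lintegral_eq [IsProbabilityMeasure μ] [IsMarkovKernel κ]
    (hrun : IsAdaSGDRun μ κ η γ w₁ T g) {t : ℕ} (ht : t < T)
    {φ : (ℕ → Vec d) × Vec d → ENNReal} (hφ : Measurable φ) :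
    ∫⁻ ω, φ (pastOf t (fun s => g s ω), g t ω) ∂μ =
      ∫⁻ ω, ∫⁻ x, φ (pastOf t (fun s => g s ω), x)
        ∂(κ (adaSGD η γ w₁ (fun s => g s ω) t)) ∂μ := by
  have hm := pastSigma_le ht.le hrun.measurable
  have hH := (measurable_pastOf_pastSigma (g := g) t).mono hm le_rfl
  have hgt := hrun.measurable t ht
  have : IsProbabilityMeasure (μ.map fun ω => pastOf t fun s => g s ω) :=
    Measure.isProbabilityMeasure_map hH.aemeasurable
  rw [← lintegral_map hφ (hH.prodMk hgt), hrun.map_pastOf_eq_compProd ht,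
    Measure.lintegral_compProd hφ, lintegral_map hφ.lintegral_kernel_prod_right' hH]
  simp only [Kernel.comap_apply, adaSGD_pastOf]

/-- The supermartingale argument: integrate the last factor against the kernel, given the past, and
induct. The condition `hpast` says that ψ t sees the history only before time t. -/
lemma IsAdaSGDRun.lintegral_exp_sum_le [IsProbabilityMeasure μ] [IsMarkovKernel κ]
    (hrun : IsAdaSGDRun μ κ η γ w₁ T g) {ψ : ℕ → (ℕ → Vec d) × Vec d → ℝ} {C : ENNReal}
    (hψ : ∀ t, Measurable (ψ t)) (hCtop : C ≠ ⊤) (hpast : ∀ t h x, ψ t (pastOf t h, x) = ψ t (h, x))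
    (hC : ∀ t h, ∫⁻ x, ENNReal.ofReal (Real.exp (ψ t (h, x))) ∂(κ (adaSGD η γ w₁ h t)) ≤ C)
    {n : ℕ} (hn : n ≤ T) :
    ∫⁻ ω, ENNReal.ofReal (Real.exp (∑ t ∈ Finset.range n, ψ t (fun s => g s ω, g t ω))) ∂μ
      ≤ C ^ n := by
  induction n with
  | zero => simp
  | succ n ih =>
    have hsum : ∀ h : ℕ → Vec d, ∑ t ∈ Finset.range n, ψ t (pastOf n h, pastOf n h t) =
        ∑ t ∈ Finset.range n, ψ t (h, h t) := fun h =>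
      Finset.sum_congr rfl fun t ht => by
        have ht := Finset.mem_range.1 ht
        rw [pastOf_apply ht, ← hpast t (pastOf n h), pastOf_pastOf ht.le, hpast]
    have h1 : ∀ ω, ENNReal.ofReal
        (Real.exp (∑ t ∈ Finset.range (n + 1), ψ t (fun s => g s ω, g t ω))) =
        (fun p : (ℕ → Vec d) × Vec d =>
          ENNReal.ofReal (Real.exp (∑ t ∈ Finset.range n, ψ t (p.1, p.1 t))) *
          ENNReal.ofReal (Real.exp (ψ n p))) (pastOf n (fun s => g s ω), g n ω) := by
      intro ω
      simp only
      rw [Finset.sum_range_succ, Real.exp_add, ENNReal.ofReal_mul (Real.exp_pos _).le, hpast,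
        hsum]
    have hA : Measurable fun h : ℕ → Vec d =>
        ENNReal.ofReal (Real.exp (∑ t ∈ Finset.range n, ψ t (h, h t))) := by
      have hs : ∀ t ∈ Finset.range n, Measurable fun h : ℕ → Vec d => ψ t (h, h t) :=
        fun t _ => (hψ t).comp (measurable_id.prodMk (measurable_pi_apply t))
      exact (Real.measurable_exp.comp (Finset.measurable_fun_sum _ hs)).ennreal_ofReal
    have hB : Measurable fun p => ENNReal.ofReal (Real.exp (ψ n p)) :=
      (Real.measurable_exp.comp (hψ n)).ennreal_ofReal
    have hAB : Measurable fun p : (ℕ → Vec d) × Vec d =>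
        ENNReal.ofReal (Real.exp (∑ t ∈ Finset.range n, ψ t (p.1, p.1 t))) *
          ENNReal.ofReal (Real.exp (ψ n p)) := (hA.comp measurable_fst).mul hB
    rw [lintegral_congr h1, hrun.lintegral_eq (t := n) (by omega) hAB]
    calc _ ≤ ∫⁻ ω, ENNReal.ofReal
            (Real.exp (∑ t ∈ Finset.range n, ψ t (fun s => g s ω, g t ω))) * C ∂μ := by
          refine lintegral_mono fun ω => ?_
          have hBω : Measurable fun x => ENNReal.ofReal (Real.exp (ψ n (fun s => g s ω, x))) :=
            hB.comp measurable_prodMk_left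
          simp only [hpast, hsum]
          rw [lintegral_const_mul _ hBω]
          exact mul_le_mul' le_rfl (hC n _)
      _ ≤ _ := by
          rw [lintegral_mul_const', pow_succ]
          · exact mul_le_mul' (ih (by omega)) le_rfl
          · exact hCtop

/-- Markov's inequality with (1 + ε)^n ≤ e^{Tε} ≤ e ≤ 3, then a union bound over the T + 1 values of
n. -/
lemma IsAdaSGDRun.measure_exists_lt_sum_le [IsProbabilityMeasure μ] [IsMarkovKernel κ]
    (hrun : IsAdaSGDRun μ κ η γ w₁ T g) {ψ : ℕ → (ℕ → Vec d) × Vec d → ℝ} {ε : ℝ} (hε : 0 ≤ ε)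
    (hTε : T * ε ≤ 1)
    (hψ : ∀ t, Measurable (ψ t)) (hpast : ∀ t h x, ψ t (pastOf t h, x) = ψ t (h, x))
    (hC : ∀ t h, ∫⁻ x, ENNReal.ofReal (Real.exp (ψ t (h, x))) ∂(κ (adaSGD η γ w₁ h t))
      ≤ ENNReal.ofReal (1 + ε)) (Λ : ℝ) :
    μ {ω | ∃ n ≤ T, Λ < ∑ t ∈ Finset.range n, ψ t (fun s => g s ω, g t ω)}
      ≤ ENNReal.ofReal ((T + 1) * (3 * Real.exp (-Λ))) := by
  have key : ∀ n ≤ T, μ {ω | Λ < ∑ t ∈ Finset.range n, ψ t (fun s => g s ω, g t ω)}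
      ≤ ENNReal.ofReal (3 * Real.exp (-Λ)) := by
    intro n hn
    have h1 := hrun.lintegral_exp_sum_le hψ ENNReal.ofReal_ne_top hpast hC hn
    have hm : Measurable fun ω => ENNReal.ofReal
        (Real.exp (∑ t ∈ Finset.range n, ψ t (fun s => g s ω, g t ω))) := by
      have hs : ∀ t ∈ Finset.range n, Measurable fun ω => ψ t (fun s => g s ω, g t ω) := by
        intro t ht
        have ht := (Finset.mem_range.1 ht).trans_le hn
        have hH := (measurable_pastOf_pastSigma (g := g) t).mono
          (pastSigma_le ht.le hrun.measurable) le_rfl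
        have := (hψ t).comp (hH.prodMk (hrun.measurable t ht))
        simpa only [Function.comp_def, hpast] using this
      exact (Real.measurable_exp.comp (Finset.measurable_fun_sum _ hs)).ennreal_ofReal
    have h2 := mul_meas_ge_le_lintegral (μ := μ) hm (ENNReal.ofReal (Real.exp Λ))
    have h3 : (1 + ε) ^ n ≤ 3 := by
      calc (1 + ε) ^ n ≤ (Real.exp ε) ^ n := by
            gcongr; linarith [Real.add_one_le_exp ε]
        _ = Real.exp (n * ε) := (Real.exp_nat_mul ε n).symm
        _ ≤ Real.exp 1 := by
            gcongr
            exact (mul_le_mul_of_nonneg_right (Nat.cast_le.2 hn) hε).trans hTε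
        _ ≤ 3 := Real.exp_one_lt_three.le
    have h4 : μ {ω | Λ < ∑ t ∈ Finset.range n, ψ t (fun s => g s ω, g t ω)} ≤
        μ {ω | ENNReal.ofReal (Real.exp Λ) ≤ ENNReal.ofReal
          (Real.exp (∑ t ∈ Finset.range n, ψ t (fun s => g s ω, g t ω)))} :=
      measure_mono fun ω hω => ENNReal.ofReal_le_ofReal (Real.exp_le_exp.2 (le_of_lt hω))
    have h5 : ENNReal.ofReal (Real.exp Λ) *
        μ {ω | Λ < ∑ t ∈ Finset.range n, ψ t (fun s => g s ω, g t ω)} ≤ ENNReal.ofReal 3 := by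
      refine (mul_le_mul' le_rfl h4).trans (h2.trans (h1.trans ?_))
      rw [← ENNReal.ofReal_pow (by linarith)]
      exact ENNReal.ofReal_le_ofReal h3
    rw [Real.exp_neg, ← div_eq_mul_inv, ENNReal.ofReal_div_of_pos (Real.exp_pos _),
      ENNReal.le_div_iff_mul_le (Or.inl (by simpa using Real.exp_pos Λ))
        (Or.inl ENNReal.ofReal_ne_top), mul_comm]
    exact h5
  calc _ ≤ μ (⋃ n ∈ Finset.range (T + 1),
        {ω | Λ < ∑ t ∈ Finset.range n, ψ t (fun s => g s ω, g t ω)}) := by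
        refine measure_mono fun ω hω => ?_
        obtain ⟨n, hn, h⟩ := hω
        exact Set.mem_biUnion (Finset.mem_coe.2 (Finset.mem_range.2 (by omega))) h
    _ ≤ ∑ n ∈ Finset.range (T + 1),
        μ {ω | Λ < ∑ t ∈ Finset.range n, ψ t (fun s => g s ω, g t ω)} :=
        measure_biUnion_finset_le _ _
    _ ≤ ∑ n ∈ Finset.range (T + 1), ENNReal.ofReal (3 * Real.exp (-Λ)) :=
        Finset.sum_le_sum fun n hn => key n (by simpa [Nat.lt_succ_iff] using hn)
    _ = _ := by
        rw [Finset.sum_const, Finset.card_range, nsmul_eq_mul, ENNReal.ofReal_mul (by positivity)]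
        rw [← Nat.cast_succ, ENNReal.ofReal_mul (Nat.cast_nonneg _), ENNReal.ofReal_natCast,
          ENNReal.ofReal_mul (by positivity)]

/-- The noise proxy `σ₀² + σ₁² ‖∇ f(w)‖²` at `w`. -/
noncomputable def noiseProxy (σ₀ σ₁ : ℝ) (f : Vec d → ℝ) (w : Vec d) : ℝ := σ₀ ^ 2 + σ₁ ^ 2 * ‖gradient f w‖ ^ 2

lemma noiseProxy_nonneg (w : Vec d) : 0 ≤ noiseProxy σ₀ σ₁ f w := by
  unfold noiseProxy; positivity

lemma IsSubGaussianAffine.tail (ho : IsGradientOracle f κ) (hs : IsSubGaussianAffine σ₀ σ₁ κ)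
    (w : Vec d) (t : ℝ) (ht : 0 < t) : (κ w).real {x | t ≤ ‖x - gradient f w‖} ≤
      if noiseProxy σ₀ σ₁ f w = 0 then 0 else 2 * Real.exp (-(t ^ 2 / noiseProxy σ₀ σ₁ f w)) := by
  have := hs w t ht
  rwa [(ho w).2] at this

lemma IsAdaSGDRun.measure_exists_martingale_le [IsProbabilityMeasure μ] [IsMarkovKernel κ]
    (hrun : IsAdaSGDRun μ κ η γ w₁ T g) (hf : IsSmoothWith β f)
    (ho : IsGradientOracle f κ) (hs : IsSubGaussianAffine σ₀ σ₁ κ) (hΛ : 1 ≤ Λ)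
    (hT : T * (3 / 2 * Real.exp (-Λ)) ≤ 1) {u : ℕ → (ℕ → Vec d) → Vec d}
    (hu : ∀ t, Measurable (u t)) (hpast : ∀ t h, u t (pastOf t h) = u t h)
    (hbd : ∀ t h, ‖u t h‖ * √(Λ * noiseProxy σ₀ σ₁ f (adaSGD η γ w₁ h t)) ≤ 1 / 2) :
    μ {ω | ∃ n ≤ T, Λ < ∑ t ∈ Finset.range n,
      (truncInner Λ (noiseProxy σ₀ σ₁ f (adaSGD η γ w₁ (fun s => g s ω) t)) (u t fun s => g s ω)
        (gradient f (adaSGD η γ w₁ (fun s => g s ω) t)) (g t ω) -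
      truncInner Λ (noiseProxy σ₀ σ₁ f (adaSGD η γ w₁ (fun s => g s ω) t)) (u t fun s => g s ω)
        (gradient f (adaSGD η γ w₁ (fun s => g s ω) t)) (g t ω) ^ 2)}
      ≤ ENNReal.ofReal ((T + 1) * (3 * Real.exp (-Λ))) := by
  have hgw : ∀ t, Measurable fun p : (ℕ → Vec d) × Vec d =>
      gradient f (adaSGD η γ w₁ p.1 t) := fun t =>
    hf.continuous_gradient.measurable.comp ((measurable_adaSGD η γ w₁ t).comp measurable_fst)
  have hZ : ∀ t, Measurable fun p : (ℕ → Vec d) × Vec d =>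
      truncInner Λ (noiseProxy σ₀ σ₁ f (adaSGD η γ w₁ p.1 t)) (u t p.1)
        (gradient f (adaSGD η γ w₁ p.1 t)) p.2 := by
    intro t
    unfold truncInner noiseProxy
    have h1 := measurable_snd.sub (hgw t)
    refine Measurable.ite (measurableSet_le (h1.norm.pow_const 2)
      ((measurable_const.add (((hgw t).norm.pow_const 2).const_mul _)).const_mul _)) ?_
      measurable_const
    exact ((hu t).comp measurable_fst).inner h1
  have h1 := hrun.measure_exists_lt_sum_le (ε := 3 / 2 * Real.exp (-Λ)) (ψ := fun t p =>
      truncInner Λ (noiseProxy σ₀ σ₁ f (adaSGD η γ w₁ p.1 t)) (u t p.1)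
        (gradient f (adaSGD η γ w₁ p.1 t)) p.2 -
      truncInner Λ (noiseProxy σ₀ σ₁ f (adaSGD η γ w₁ p.1 t)) (u t p.1)
        (gradient f (adaSGD η γ w₁ p.1 t)) p.2 ^ 2)
    (by positivity) hT (fun t => (hZ t).sub ((hZ t).pow_const 2))
    (fun t h x => by simp only [adaSGD_pastOf, hpast])
    (fun t h => by
      have h2 := lintegral_exp_truncInner_le (noiseProxy_nonneg (adaSGD η γ w₁ h t)) hΛ
        (ho (adaSGD η γ w₁ h t)).1 (ho (adaSGD η γ w₁ h t)).2
        (hs.tail ho (adaSGD η γ w₁ h t)) (hbd t h)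
      exact h2) Λ
  exact h1

lemma IsAdaSGDRun.measure_exists_noise_le [IsProbabilityMeasure μ] [IsMarkovKernel κ]
    (hrun : IsAdaSGDRun μ κ η γ w₁ T g) (hf : IsSmoothWith β f)
    (ho : IsGradientOracle f κ) (hs : IsSubGaussianAffine σ₀ σ₁ κ) (hΛ : 0 < Λ) :
    μ {ω | ∃ t < T, Λ * noiseProxy σ₀ σ₁ f (adaSGD η γ w₁ (fun s => g s ω) t) <
      ‖g t ω - gradient f (adaSGD η γ w₁ (fun s => g s ω) t)‖ ^ 2}
      ≤ ENNReal.ofReal (T * (2 * Real.exp (-Λ))) := by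
  have key : ∀ t < T, μ {ω | Λ * noiseProxy σ₀ σ₁ f (adaSGD η γ w₁ (fun s => g s ω) t) <
      ‖g t ω - gradient f (adaSGD η γ w₁ (fun s => g s ω) t)‖ ^ 2}
      ≤ ENNReal.ofReal (2 * Real.exp (-Λ)) := by
    intro t ht
    have hgw : Measurable fun p : (ℕ → Vec d) × Vec d =>
        gradient f (adaSGD η γ w₁ p.1 t) :=
      hf.continuous_gradient.measurable.comp ((measurable_adaSGD η γ w₁ t).comp measurable_fst)
    set S : Set ((ℕ → Vec d) × Vec d) := {p | Λ * noiseProxy σ₀ σ₁ f (adaSGD η γ w₁ p.1 t) <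
      ‖p.2 - gradient f (adaSGD η γ w₁ p.1 t)‖ ^ 2} with hS
    have hSm : MeasurableSet S := by
      unfold noiseProxy at hS
      exact measurableSet_lt
        ((measurable_const.add ((hgw.norm.pow_const 2).const_mul _)).const_mul _)
        ((measurable_snd.sub hgw).norm.pow_const 2)
    have hH := (measurable_pastOf_pastSigma (g := g) t).mono
      (pastSigma_le ht.le hrun.measurable) le_rfl
    have h1 := hrun.lintegral_eq ht (φ := S.indicator fun _ => 1)
      (measurable_const.indicator hSm)
    have h2 : ∀ ω, S.indicator (fun _ => (1 : ENNReal)) (pastOf t (fun s => g s ω), g t ω) =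
        ((fun ω => (pastOf t (fun s => g s ω), g t ω)) ⁻¹' S).indicator (fun _ => 1) ω :=
      fun ω => rfl
    rw [lintegral_congr h2, lintegral_indicator ((hH.prodMk (hrun.measurable t ht)) hSm),
      setLIntegral_const, one_mul] at h1
    have h3 : {ω | Λ * noiseProxy σ₀ σ₁ f (adaSGD η γ w₁ (fun s => g s ω) t) <
      ‖g t ω - gradient f (adaSGD η γ w₁ (fun s => g s ω) t)‖ ^ 2} =
        (fun ω => (pastOf t (fun s => g s ω), g t ω)) ⁻¹' S := by
      ext ω
      simp only [hS, Set.mem_preimage, Set.mem_ofPred_eq, adaSGD_pastOf]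
    rw [h3, h1]
    calc _ ≤ ∫⁻ _, ENNReal.ofReal (2 * Real.exp (-Λ)) ∂μ := by
          refine lintegral_mono fun ω => ?_
          have h4 : ∀ x, S.indicator (fun _ => (1 : ENNReal)) (pastOf t (fun s => g s ω), x) =
              {x | Λ * noiseProxy σ₀ σ₁ f (adaSGD η γ w₁ (fun s => g s ω) t) <
                ‖x - gradient f (adaSGD η γ w₁ (fun s => g s ω) t)‖ ^ 2}.indicator
                (fun _ => 1) x := by
            intro x
            simp only [Set.indicator, hS, Set.mem_ofPred_eq, adaSGD_pastOf]
          rw [lintegral_congr h4, lintegral_indicator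
            (measurableSet_lt measurable_const (by fun_prop)), setLIntegral_const, one_mul,
            ← ofReal_measureReal]
          exact ENNReal.ofReal_le_ofReal
            (measureReal_lt_norm_sub_sq_le (noiseProxy_nonneg _) hΛ (hs.tail ho _))
      _ = _ := by simp
  calc _ ≤ μ (⋃ t ∈ Finset.range T,
        {ω | Λ * noiseProxy σ₀ σ₁ f (adaSGD η γ w₁ (fun s => g s ω) t) <
          ‖g t ω - gradient f (adaSGD η γ w₁ (fun s => g s ω) t)‖ ^ 2}) := by
        refine measure_mono fun ω hω => ?_
        obtain ⟨n, hn, h⟩ := hω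
        exact Set.mem_biUnion (Finset.mem_coe.2 (Finset.mem_range.2 hn)) h
    _ ≤ ∑ t ∈ Finset.range T, ENNReal.ofReal (2 * Real.exp (-Λ)) :=
        (measure_biUnion_finset_le _ _).trans
          (Finset.sum_le_sum fun n hn => key n (Finset.mem_range.1 hn))
    _ = _ := by
        rw [Finset.sum_const, Finset.card_range, nsmul_eq_mul,
          ENNReal.ofReal_mul (Nat.cast_nonneg _), ENNReal.ofReal_natCast]

end Trajectory

/-! ### Deterministic sums of adaptive gradient methods. -/

section Sums

/-- The regularized sum `γ² + ∑_{s < t} ‖g s‖²` of squared norms. -/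
noncomputable def sqSum {d : ℕ} (γ : ℝ) (g : ℕ → Vec d) (t : ℕ) : ℝ :=
  γ ^ 2 + ∑ s ∈ Finset.range t, ‖g s‖ ^ 2

variable {d : ℕ} {γ : ℝ} {g : ℕ → Vec d}

lemma sqSum_succ (t : ℕ) : sqSum γ g (t + 1) = sqSum γ g t + ‖g t‖ ^ 2 := by
  simp [sqSum, Finset.sum_range_succ, add_assoc]

lemma sq_le_sqSum (t : ℕ) : γ ^ 2 ≤ sqSum γ g t := by
  unfold sqSum
  have : 0 ≤ ∑ s ∈ Finset.range t, ‖g s‖ ^ 2 := Finset.sum_nonneg fun _ _ => by positivity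
  linarith

lemma sqSum_pos (hγ : 0 < γ) (t : ℕ) : 0 < sqSum γ g t :=
  (pow_pos hγ 2).trans_le (sq_le_sqSum t)

/-- Each term is 1 - S_n/S_{n+1} ≤ log(S_{n+1}/S_n), which telescopes. -/
lemma sum_sq_div_sqSum_le (hγ : 0 < γ) (n : ℕ) :
    ∑ t ∈ Finset.range n, ‖g t‖ ^ 2 / sqSum γ g (t + 1) ≤ Real.log (sqSum γ g n / γ ^ 2) := by
  induction n with
  | zero => simp [sqSum, div_self (pow_pos hγ 2).ne']
  | succ n ih =>
    rw [Finset.sum_range_succ]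
    have h0 := sqSum_pos (g := g) hγ n
    have h1 := sqSum_pos (g := g) hγ (n + 1)
    have h2 := Real.log_le_sub_one_of_pos (div_pos h0 h1)
    have h3 : ‖g n‖ ^ 2 / sqSum γ g (n + 1) = 1 - sqSum γ g n / sqSum γ g (n + 1) := by
      rw [eq_sub_iff_add_eq, ← add_div, add_comm, ← sqSum_succ, div_self h1.ne']
    rw [Real.log_div h0.ne' h1.ne'] at h2
    rw [Real.log_div h0.ne' (pow_pos hγ 2).ne'] at ih
    rw [Real.log_div h1.ne' (pow_pos hγ 2).ne']
    linarith

lemma sum_sq_div_sqrt_sqSum_le (hγ : 0 < γ) (n : ℕ) :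
    ∑ t ∈ Finset.range n, ‖g t‖ ^ 2 / √(sqSum γ g (t + 1)) ≤ 2 * (√(sqSum γ g n) - γ) := by
  induction n with
  | zero => simp [sqSum, Real.sqrt_sq hγ.le]
  | succ n ih =>
    rw [Finset.sum_range_succ]
    have h0 := sqSum_pos (g := g) hγ n
    have h1 := sqSum_pos (g := g) hγ (n + 1)
    have h2 : ‖g n‖ ^ 2 / √(sqSum γ g (n + 1)) ≤ 2 * (√(sqSum γ g (n + 1)) - √(sqSum γ g n)) := by
      rw [div_le_iff₀ (Real.sqrt_pos.2 h1)]
      have e1 := Real.sq_sqrt h0.le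
      have e2 := Real.sq_sqrt h1.le
      have e3 := sqSum_succ (γ := γ) (g := g) n
      nlinarith [sq_nonneg (√(sqSum γ g (n + 1)) - √(sqSum γ g n))]
    linarith

lemma sqrt_sqSum_sub_le (hγ : 0 < γ) (n : ℕ) :
    √(sqSum γ g n) - γ ≤ √(∑ t ∈ Finset.range n, ‖g t‖ ^ 2) := by
  have h : 0 ≤ ∑ t ∈ Finset.range n, ‖g t‖ ^ 2 := Finset.sum_nonneg fun _ _ => by positivity
  rw [sub_le_iff_le_add, Real.sqrt_le_iff]
  refine ⟨by positivity, ?_⟩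
  have := Real.sq_sqrt h
  unfold sqSum
  nlinarith [mul_nonneg (Real.sqrt_nonneg (∑ t ∈ Finset.range n, ‖g t‖ ^ 2)) hγ.le]

/-- Summation by parts. The boundary term stays on the left so that the induction closes. -/
lemma sum_sqrt_sqSum_mul_sub_le (hγ : 0 < γ) {X : ℕ → ℝ} {D : ℝ} {n : ℕ}
    (hX : ∀ t ≤ n, X t ≤ D) :
    ∑ t ∈ Finset.range n, √(sqSum γ g (t + 1)) * (X t - X (t + 1)) + √(sqSum γ g n) * X n
      ≤ γ * X 0 + (√(sqSum γ g n) - γ) * D := by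
  induction n with
  | zero => simp [sqSum, Real.sqrt_sq hγ.le]
  | succ n ih =>
    rw [Finset.sum_range_succ]
    have h1 : √(sqSum γ g n) ≤ √(sqSum γ g (n + 1)) := by
      apply Real.sqrt_le_sqrt
      rw [sqSum_succ]
      linarith [sq_nonneg ‖g n‖]
    nlinarith [ih fun t ht => hX t (by omega), mul_le_mul_of_nonneg_left (hX n (by omega))
      (sub_nonneg.2 h1)]

end Sums

/-! ### Cost of replacing the step size by one independent of the current noise. -/

section StepComparison

/-- The squared difference of the two roots is at most |a - N|, and |a - N| ≤ N because 0 ≤ a ≤ 2N.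
Used for the function gap, where N anticipates the noise level. -/
lemma abs_inv_sqrt_sub_inv_sqrt_le {S a N : ℝ} (hS : 0 < S) (ha : 0 ≤ a) (hN : 0 ≤ N)
    (haN : a ≤ 2 * N) :
    |1 / √(S + N) - 1 / √(S + a)| ≤ √N / (√(S + a) * √(S + N)) := by
  have hP : 0 < √(S + a) := Real.sqrt_pos.2 (by linarith)
  have hQ : 0 < √(S + N) := Real.sqrt_pos.2 (by linarith)
  have e1 := Real.sq_sqrt (by linarith : 0 ≤ S + a)
  have e2 := Real.sq_sqrt (by linarith : 0 ≤ S + N)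
  have e : 1 / √(S + N) - 1 / √(S + a) = (√(S + a) - √(S + N)) / (√(S + a) * √(S + N)) := by
    field_simp
  rw [e, abs_div, abs_of_pos (mul_pos hP hQ)]
  gcongr
  apply Real.abs_le_sqrt
  rcases le_total (√(S + a)) (√(S + N)) with h | h <;> nlinarith

/-- The map a ↦ √(S + a²) is 1-Lipschitz. Used for the distance, where the error must be
proportional to the actual noise x. -/
lemma abs_inv_sqrt_sub_inv_sqrt_le' {S a p x : ℝ} (hS : 0 < S) (ha : 0 ≤ a) (hp : 0 ≤ p)
    (hx : |a - p| ≤ x) :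
    |1 / √(S + p ^ 2) - 1 / √(S + a ^ 2)| ≤ x / (√(S + a ^ 2) * √(S + p ^ 2)) := by
  have hP : 0 < √(S + a ^ 2) := Real.sqrt_pos.2 (by positivity)
  have hQ : 0 < √(S + p ^ 2) := Real.sqrt_pos.2 (by positivity)
  have e1 := Real.sq_sqrt (by positivity : 0 ≤ S + a ^ 2)
  have e2 := Real.sq_sqrt (by positivity : 0 ≤ S + p ^ 2)
  have e : 1 / √(S + p ^ 2) - 1 / √(S + a ^ 2) =
      (√(S + a ^ 2) - √(S + p ^ 2)) / (√(S + a ^ 2) * √(S + p ^ 2)) := by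
    field_simp
  rw [e, abs_div, abs_of_pos (mul_pos hP hQ)]
  gcongr
  have h1 : a ≤ √(S + a ^ 2) := Real.le_sqrt_of_sq_le (by linarith)
  have h2 : p ≤ √(S + p ^ 2) := Real.le_sqrt_of_sq_le (by linarith)
  have h3 : |√(S + a ^ 2) - √(S + p ^ 2)| * (√(S + a ^ 2) + √(S + p ^ 2)) = |a - p| * (a + p) := by
    rw [← abs_of_pos (add_pos hP hQ), ← abs_mul, ← abs_of_nonneg (add_nonneg ha hp), ← abs_mul]
    congr 1
    nlinarith
  have h4 : |√(S + a ^ 2) - √(S + p ^ 2)| * (√(S + a ^ 2) + √(S + p ^ 2)) ≤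
      x * (√(S + a ^ 2) + √(S + p ^ 2)) := by
    rw [h3]
    have := (abs_nonneg (a - p)).trans hx
    gcongr
  exact le_of_mul_le_mul_right h4 (add_pos hP hQ)

end StepComparison

/-! ### The function gap along a fixed trajectory. -/

section Path

variable {d : ℕ} {f : Vec d → ℝ} {β σ₀ σ₁ η γ Λ F ℓ : ℝ} {T : ℕ} {w g : ℕ → Vec d}
  {wstar : Vec d}

lemma noiseProxy_le (hβ : 0 ≤ β) (hf : IsSmoothWith β f) (hmin : ∀ w, f wstar ≤ f w) {x : Vec d}
    (hF : f x - f wstar ≤ F) : noiseProxy σ₀ σ₁ f x ≤ σ₀ ^ 2 + 2 * σ₁ ^ 2 * β * F := by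
  unfold noiseProxy
  have h1 := hf.norm_gradient_sq_le hβ hmin x
  have h2 : 2 * β * (f x - f wstar) ≤ 2 * β * F := by gcongr
  have h3 : σ₁ ^ 2 * ‖gradient f x‖ ^ 2 ≤ σ₁ ^ 2 * (2 * β * F) := by gcongr; linarith
  linarith

lemma norm_sq_le_two_mul {x y : Vec d} {a : ℝ} (h : ‖x - y‖ ^ 2 ≤ a) :
    ‖x‖ ^ 2 ≤ 2 * (‖y‖ ^ 2 + a) := by
  have h1 : ‖x‖ ≤ ‖x - y‖ + ‖y‖ := by simpa using norm_add_le (x - y) y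
  nlinarith [norm_nonneg x, norm_nonneg y, norm_nonneg (x - y), sq_nonneg (‖x - y‖ - ‖y‖),
    pow_le_pow_left₀ (norm_nonneg x) h1 2]

/-- The step size of the decorrelated step at time `t` that anticipates the noise. -/
noncomputable def proxyStep (η γ Λ σ₀ σ₁ : ℝ) (f : Vec d → ℝ) (w g : ℕ → Vec d) (t : ℕ) : ℝ :=
  η / √(sqSum γ g t + (‖gradient f (w t)‖ ^ 2 + Λ * noiseProxy σ₀ σ₁ f (w t)))

/-- Smooth descent with η_t replaced by the predictable `proxyStep`. The replacement error is a
product of ‖∇f(w_t)‖ and ‖g_t‖; by AM-GM one half of the descent term pays for it, up to a multiple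
of ‖g_t‖²/S_{t+1}. The other half is kept for the martingale. -/
lemma gap_step_le (hη : 0 < η) (hγ : 0 < γ) (hΛ : 0 ≤ Λ) (hf : IsSmoothWith β f)
    {t : ℕ} (hw : w (t + 1) = w t - (η / √(sqSum γ g (t + 1))) • g t)
    (hE : ‖g t - gradient f (w t)‖ ^ 2 ≤ Λ * noiseProxy σ₀ σ₁ f (w t)) {N : ℝ}
    (hN : ‖gradient f (w t)‖ ^ 2 + Λ * noiseProxy σ₀ σ₁ f (w t) ≤ N) :
    f (w (t + 1)) - f (w t) ≤
      -(1 / 2 * (proxyStep η γ Λ σ₀ σ₁ f w g t * ‖gradient f (w t)‖ ^ 2)) +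
      ⟪(-proxyStep η γ Λ σ₀ σ₁ f w g t) • gradient f (w t), g t - gradient f (w t)⟫_ℝ +
      (η * √N + β / 2 * η ^ 2) * (‖g t‖ ^ 2 / sqSum γ g (t + 1)) := by
  set p := ‖gradient f (w t)‖ with hp
  set M := p ^ 2 + Λ * noiseProxy σ₀ σ₁ f (w t) with hM
  have hM0 : 0 ≤ M := by have := noiseProxy_nonneg (σ₀ := σ₀) (σ₁ := σ₁) (f := f) (w t); positivity
  have hS := sqSum_pos (g := g) hγ t
  have hS1 := sqSum_succ (γ := γ) (g := g) t
  have hdesc := hf.le_quadratic (w t) (w (t + 1))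
  have hstep : w (t + 1) - w t = -((η / √(sqSum γ g (t + 1))) • g t) := by rw [hw]; abel
  have hcmp := abs_inv_sqrt_sub_inv_sqrt_le hS (sq_nonneg ‖g t‖) hM0 (norm_sq_le_two_mul hE)
  rw [← hS1] at hcmp
  set P := √(sqSum γ g (t + 1)) with hP
  set Q := √(sqSum γ g t + M) with hQ
  have hP0 : 0 < P := Real.sqrt_pos.2 (sqSum_pos hγ _)
  have hQ0 : 0 < Q := Real.sqrt_pos.2 (by linarith)
  have hP2 : P ^ 2 = sqSum γ g (t + 1) := Real.sq_sqrt (sqSum_pos hγ _).le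
  have hMQ : √M ≤ Q := Real.sqrt_le_sqrt (by linarith)
  have hMN : √M ≤ √N := Real.sqrt_le_sqrt hN
  rw [hstep, inner_neg_right, inner_smul_right, norm_neg, norm_smul, Real.norm_of_nonneg
    (by positivity)] at hdesc
  have hprox : proxyStep η γ Λ σ₀ σ₁ f w g t = η / Q := rfl
  rw [hprox, inner_smul_left, inner_sub_right, real_inner_self_eq_norm_sq, ← hp, ← hP2]
  set c := ⟪gradient f (w t), g t⟫_ℝ with hc
  have hcabs : |c| ≤ p * ‖g t‖ := abs_real_inner_le_norm _ _
  have h1 : (1 / Q - 1 / P) * c ≤ 1 / 2 * (p ^ 2 / Q) + √N * (‖g t‖ ^ 2 / P ^ 2) := by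
    calc (1 / Q - 1 / P) * c ≤ |1 / Q - 1 / P| * |c| := by
          rw [← abs_mul]; exact le_abs_self _
      _ ≤ √M / (P * Q) * (p * ‖g t‖) := by gcongr
      _ = (p * (√M * (‖g t‖ / P))) / Q := by field_simp
      _ ≤ (p ^ 2 / 2 + (√M * (‖g t‖ / P)) ^ 2 / 2) / Q := by
          gcongr
          nlinarith [sq_nonneg (p - √M * (‖g t‖ / P))]
      _ = 1 / 2 * (p ^ 2 / Q) + (√M / Q) * √M * (‖g t‖ ^ 2 / P ^ 2) / 2 := by
          field_simp
      _ ≤ 1 / 2 * (p ^ 2 / Q) + 1 * √M * (‖g t‖ ^ 2 / P ^ 2) / 2 := by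
          gcongr
          exact (div_le_one hQ0).2 hMQ
      _ ≤ 1 / 2 * (p ^ 2 / Q) + √N * (‖g t‖ ^ 2 / P ^ 2) := by
          have : 0 ≤ √M * (‖g t‖ ^ 2 / P ^ 2) := by positivity
          have : √M * (‖g t‖ ^ 2 / P ^ 2) ≤ √N * (‖g t‖ ^ 2 / P ^ 2) := by gcongr
          linarith
  have h2 := mul_le_mul_of_nonneg_left h1 hη.le
  have e1 : β / 2 * (η / P * ‖g t‖) ^ 2 = β / 2 * η ^ 2 * (‖g t‖ ^ 2 / P ^ 2) := by
    field_simp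
  have e2 : η * ((1 / Q - 1 / P) * c) = η / Q * c - η / P * c := by ring
  have e3 : η * (1 / 2 * (p ^ 2 / Q)) = 1 / 2 * (η / Q * p ^ 2) := by ring
  simp only [conj_trivial]
  nlinarith

/-- Strong induction: while earlier gaps are at most F, the squared noise products are at most η√N
times the descent terms. Dividing by 2η√N makes the quadratic part of `hM` at most the remaining
half of the descent, and the two cancel. -/
lemma sub_le_gapBound_of_martingale (hβ : 0 ≤ β) (hη : 0 < η) (hγ : 0 < γ) (hΛ : 0 ≤ Λ)
    (hf : IsSmoothWith β f) (hmin : ∀ w, f wstar ≤ f w)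
    (hw : ∀ t, w (t + 1) = w t - (η / √(sqSum γ g (t + 1))) • g t)
    (hE : ∀ t < T, ‖g t - gradient f (w t)‖ ^ 2 ≤ Λ * noiseProxy σ₀ σ₁ f (w t))
    (hlog : ∀ n ≤ T, ∑ t ∈ Finset.range n, ‖g t‖ ^ 2 / sqSum γ g (t + 1) ≤ ℓ) {N : ℝ}
    (hN : 2 * β * F + Λ * (σ₀ ^ 2 + 2 * σ₁ ^ 2 * β * F) ≤ N)
    (hM : ∀ n ≤ T, (∀ t < n, f (w t) - f wstar ≤ F) →
      ∑ t ∈ Finset.range n, ⟪(-proxyStep η γ Λ σ₀ σ₁ f w g t) • gradient f (w t),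
          g t - gradient f (w t)⟫_ℝ ≤
        (∑ t ∈ Finset.range n, ⟪(-proxyStep η γ Λ σ₀ σ₁ f w g t) • gradient f (w t),
          g t - gradient f (w t)⟫_ℝ ^ 2) / (2 * (η * √N)) + 2 * (η * √N) * Λ)
    (hF : f (w 0) - f wstar + η * √N * (ℓ + 2 * Λ) + β / 2 * η ^ 2 * ℓ ≤ F) :
    ∀ n ≤ T, f (w n) - f wstar ≤ F := by
  intro n
  induction n using Nat.strong_induction_on with
  | _ n ih =>
  intro hn
  have hFt : ∀ t < n, f (w t) - f wstar ≤ F := fun t ht => ih t ht (by omega)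
  have hNt : ∀ t < n, ‖gradient f (w t)‖ ^ 2 + Λ * noiseProxy σ₀ σ₁ f (w t) ≤ N := by
    intro t ht
    have h1 := hf.norm_gradient_sq_le hβ hmin (w t)
    have h2 : 2 * β * (f (w t) - f wstar) ≤ 2 * β * F := by gcongr; exact hFt t ht
    have h3 := mul_le_mul_of_nonneg_left
      (noiseProxy_le (σ₀ := σ₀) (σ₁ := σ₁) hβ hf hmin (hFt t ht)) hΛ
    linarith
  have hstep : ∀ t ∈ Finset.range n, f (w (t + 1)) - f (w t) ≤
      -(1 / 2 * (proxyStep η γ Λ σ₀ σ₁ f w g t * ‖gradient f (w t)‖ ^ 2)) +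
      ⟪(-proxyStep η γ Λ σ₀ σ₁ f w g t) • gradient f (w t), g t - gradient f (w t)⟫_ℝ +
      (η * √N + β / 2 * η ^ 2) * (‖g t‖ ^ 2 / sqSum γ g (t + 1)) := fun t ht => by
    have ht := Finset.mem_range.1 ht
    exact gap_step_le hη hγ hΛ hf (hw t) (hE t (by omega)) (hNt t ht)
  have hsum := Finset.sum_le_sum hstep
  rw [Finset.sum_range_sub (fun t => f (w t)), Finset.sum_add_distrib, Finset.sum_add_distrib,
    Finset.sum_neg_distrib, ← Finset.mul_sum, ← Finset.mul_sum] at hsum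
  have hquad : (∑ t ∈ Finset.range n, ⟪(-proxyStep η γ Λ σ₀ σ₁ f w g t) • gradient f (w t),
          g t - gradient f (w t)⟫_ℝ ^ 2) / (2 * (η * √N)) ≤
      1 / 2 * ∑ t ∈ Finset.range n, proxyStep η γ Λ σ₀ σ₁ f w g t * ‖gradient f (w t)‖ ^ 2 := by
    have hst : ∀ t, 0 ≤ proxyStep η γ Λ σ₀ σ₁ f w g t := fun t => by
      unfold proxyStep; positivity
    -- The divisor 2η√N may vanish, in which case the quotient is 0 by convention; this form of the
    -- division lemma covers that case.
    refine div_le_of_le_mul₀ (by positivity) (mul_nonneg (by norm_num) (Finset.sum_nonneg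
      fun t _ => mul_nonneg (hst t) (by positivity))) ?_
    rw [Finset.mul_sum, Finset.sum_mul]
    refine Finset.sum_le_sum fun t ht => ?_
    have ht := Finset.mem_range.1 ht
    set p := ‖gradient f (w t)‖ with hp
    have hv := noiseProxy_nonneg (σ₀ := σ₀) (σ₁ := σ₁) (f := f) (w t)
    have hEt := hE t (by omega)
    have hNt' := hNt t ht
    set M := p ^ 2 + Λ * noiseProxy σ₀ σ₁ f (w t) with hM
    have hM0 : 0 ≤ M := by positivity
    have hS := sqSum_pos (g := g) hγ t
    have hprox : proxyStep η γ Λ σ₀ σ₁ f w g t = η / √(sqSum γ g t + M) := rfl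
    have hQ0 : 0 < √(sqSum γ g t + M) := Real.sqrt_pos.2 (by linarith)
    have hMQ : √M ≤ √(sqSum γ g t + M) := Real.sqrt_le_sqrt (by linarith)
    rw [inner_smul_left, hprox, conj_trivial]
    have h1 : ⟪gradient f (w t), g t - gradient f (w t)⟫_ℝ ^ 2 ≤ p ^ 2 * M := by
      have h := abs_real_inner_le_norm (gradient f (w t)) (g t - gradient f (w t))
      calc _ = |⟪gradient f (w t), g t - gradient f (w t)⟫_ℝ| ^ 2 := (sq_abs _).symm
        _ ≤ (p * ‖g t - gradient f (w t)‖) ^ 2 := by gcongr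
        _ = p ^ 2 * ‖g t - gradient f (w t)‖ ^ 2 := by ring
        _ ≤ p ^ 2 * M := by
            gcongr
            have := sq_nonneg p
            linarith
    calc (-(η / √(sqSum γ g t + M)) * ⟪gradient f (w t), g t - gradient f (w t)⟫_ℝ) ^ 2
        = (η / √(sqSum γ g t + M)) ^ 2 * ⟪gradient f (w t), g t - gradient f (w t)⟫_ℝ ^ 2 := by ring
      _ ≤ (η / √(sqSum γ g t + M)) ^ 2 * (p ^ 2 * M) := by gcongr
      _ = (η / √(sqSum γ g t + M)) * p ^ 2 * (η * (√M * (√M / √(sqSum γ g t + M)))) := by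
          rw [← mul_div_assoc √M, ← sq, Real.sq_sqrt hM0]
          ring
      _ ≤ (η / √(sqSum γ g t + M)) * p ^ 2 * (η * (√N * 1)) := by
          gcongr
          exact (div_le_one hQ0).2 hMQ
      _ = _ := by ring
  have hmart := hM n hn hFt
  have hl := mul_le_mul_of_nonneg_left (hlog n hn)
    (by positivity : 0 ≤ η * √N + β / 2 * η ^ 2)
  linarith

end Path

/-! ### Distance to the minimizer and regret along a fixed trajectory. -/

section Path

variable {d : ℕ} {f : Vec d → ℝ} {β σ₀ σ₁ η γ Λ F ℓ : ℝ} {T : ℕ} {w g : ℕ → Vec d}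
  {wstar : Vec d}

lemma sqrt_add_le {a b : ℝ} (ha : 0 ≤ a) (hb : 0 ≤ b) : √(a + b) ≤ √a + √b := by
  rw [Real.sqrt_le_iff]
  refine ⟨by positivity, ?_⟩
  nlinarith [Real.sq_sqrt ha, Real.sq_sqrt hb, mul_nonneg (Real.sqrt_nonneg a) (Real.sqrt_nonneg b)]

/-- The square of the denominator of the decorrelated step at time `t`. -/
noncomputable def gradSqSum (γ : ℝ) (f : Vec d → ℝ) (w g : ℕ → Vec d) (t : ℕ) : ℝ :=
  sqSum γ g t + ‖gradient f (w t)‖ ^ 2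

/-- A bound for the ratio of `sqSum γ g (t + 1)` and `gradSqSum γ f w g t`. -/
noncomputable def noiseRatio (β σ₀ σ₁ γ Λ F : ℝ) : ℝ :=
  2 + 2 * Λ * (σ₀ ^ 2 + 2 * σ₁ ^ 2 * β * F) / γ ^ 2

lemma gradSqSum_pos (hγ : 0 < γ) (t : ℕ) : 0 < gradSqSum γ f w g t := by
  have := sqSum_pos (g := g) hγ t
  unfold gradSqSum; positivity

/-- With V the noise bound, ‖g_t‖² ≤ 2(‖∇f(w_t)‖² + V), and V is at most V/γ² times the denominator
because the latter is at least γ². -/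
lemma sqSum_le_noiseRatio_mul (hγ : 0 < γ) {t : ℕ}
    (hE : ‖g t - gradient f (w t)‖ ^ 2 ≤ Λ * (σ₀ ^ 2 + 2 * σ₁ ^ 2 * β * F)) :
    sqSum γ g (t + 1) ≤ noiseRatio β σ₀ σ₁ γ Λ F * gradSqSum γ f w g t := by
  have h1 := norm_sq_le_two_mul hE
  have h2 := sq_le_sqSum (γ := γ) (g := g) t
  have h0 : 0 ≤ Λ * (σ₀ ^ 2 + 2 * σ₁ ^ 2 * β * F) := (sq_nonneg _).trans hE
  set V := Λ * (σ₀ ^ 2 + 2 * σ₁ ^ 2 * β * F) with hV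
  have h3 : noiseRatio β σ₀ σ₁ γ Λ F = 2 + 2 * V / γ ^ 2 := by rw [noiseRatio, hV]; ring
  rw [sqSum_succ, h3, add_mul]
  have hS : γ ^ 2 ≤ gradSqSum γ f w g t := by
    unfold gradSqSum; linarith [sq_nonneg ‖gradient f (w t)‖]
  have h4 : 2 * V ≤ 2 * V / γ ^ 2 * gradSqSum γ f w g t := by
    rw [div_mul_eq_mul_div, le_div_iff₀ (pow_pos hγ 2)]
    gcongr
  unfold gradSqSum at *
  linarith [sq_nonneg γ]

/-- Expanding ‖g‖² = ‖∇f + ξ‖² bounds ‖∇f‖² by ‖g‖² - 2⟨∇f, ξ⟩. After division by `gradSqSum` the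
squared noise products are at most R times the summands to be bounded, so with B = 8R and the factor
2 a quarter of that sum moves to the left; this gives the 4/3. -/
lemma sum_gradient_sq_div_le (hγ : 0 < γ) (hR : 1 ≤ noiseRatio β σ₀ σ₁ γ Λ F) {n : ℕ}
    (hE : ∀ t < n, ‖g t - gradient f (w t)‖ ^ 2 ≤ Λ * (σ₀ ^ 2 + 2 * σ₁ ^ 2 * β * F))
    (hlog : ∑ t ∈ Finset.range n, ‖g t‖ ^ 2 / sqSum γ g (t + 1) ≤ ℓ)
    (hM : ∑ t ∈ Finset.range n, ⟪(-(gradSqSum γ f w g t)⁻¹) • gradient f (w t),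
          g t - gradient f (w t)⟫_ℝ ≤
        (∑ t ∈ Finset.range n, ⟪(-(gradSqSum γ f w g t)⁻¹) • gradient f (w t),
          g t - gradient f (w t)⟫_ℝ ^ 2) / (8 * noiseRatio β σ₀ σ₁ γ Λ F) +
          8 * noiseRatio β σ₀ σ₁ γ Λ F * Λ) :
    ∑ t ∈ Finset.range n, ‖g t‖ ^ 2 / gradSqSum γ f w g t ≤ noiseRatio β σ₀ σ₁ γ Λ F * ℓ ∧
    ∑ t ∈ Finset.range n, ‖gradient f (w t)‖ ^ 2 / gradSqSum γ f w g t ≤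
      4 / 3 * noiseRatio β σ₀ σ₁ γ Λ F * (ℓ + 16 * Λ) := by
  set R := noiseRatio β σ₀ σ₁ γ Λ F with hRdef
  have hX : ∑ t ∈ Finset.range n, ‖g t‖ ^ 2 / gradSqSum γ f w g t ≤ R * ℓ := by
    refine le_trans ?_ (mul_le_mul_of_nonneg_left hlog (by linarith))
    rw [Finset.mul_sum]
    refine Finset.sum_le_sum fun t ht => ?_
    have h := sqSum_le_noiseRatio_mul hγ (hE t (Finset.mem_range.1 ht))
    have h0 := gradSqSum_pos (f := f) (w := w) (g := g) hγ t
    rw [← mul_div_assoc, div_le_div_iff₀ h0 (sqSum_pos hγ _)]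
    nlinarith [mul_le_mul_of_nonneg_left h (sq_nonneg ‖g t‖)]
  refine ⟨hX, ?_⟩
  have h1 : ∀ t ∈ Finset.range n, ‖gradient f (w t)‖ ^ 2 / gradSqSum γ f w g t ≤
      ‖g t‖ ^ 2 / gradSqSum γ f w g t +
      2 * ⟪(-(gradSqSum γ f w g t)⁻¹) • gradient f (w t), g t - gradient f (w t)⟫_ℝ := by
    intro t ht
    have h0 := gradSqSum_pos (f := f) (w := w) (g := g) hγ t
    have h2 : ‖g t‖ ^ 2 = ‖gradient f (w t)‖ ^ 2 +
        2 * ⟪gradient f (w t), g t - gradient f (w t)⟫_ℝ + ‖g t - gradient f (w t)‖ ^ 2 := by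
      rw [← norm_add_sq_real]; simp
    rw [inner_smul_left, conj_trivial, div_eq_mul_inv, div_eq_mul_inv, h2]
    have h3 : 0 ≤ ‖g t - gradient f (w t)‖ ^ 2 * (gradSqSum γ f w g t)⁻¹ := by positivity
    linarith
  have h2 : ∀ t ∈ Finset.range n,
      ⟪(-(gradSqSum γ f w g t)⁻¹) • gradient f (w t), g t - gradient f (w t)⟫_ℝ ^ 2 ≤
      R * (‖gradient f (w t)‖ ^ 2 / gradSqSum γ f w g t) := by
    intro t ht
    have h0 := gradSqSum_pos (f := f) (w := w) (g := g) hγ t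
    have hEt := hE t (Finset.mem_range.1 ht)
    have hxi : ‖g t - gradient f (w t)‖ ^ 2 * (gradSqSum γ f w g t)⁻¹ ≤ R := by
      rw [← div_eq_mul_inv, div_le_iff₀ h0, hRdef, noiseRatio]
      have h2 := sq_le_sqSum (γ := γ) (g := g) t
      have hS : γ ^ 2 ≤ gradSqSum γ f w g t := by
        unfold gradSqSum; linarith [sq_nonneg ‖gradient f (w t)‖]
      set V := Λ * (σ₀ ^ 2 + 2 * σ₁ ^ 2 * β * F) with hV
      have hV0 : 0 ≤ V := (sq_nonneg _).trans hEt
      have h4 : 2 * V ≤ 2 * V / γ ^ 2 * gradSqSum γ f w g t := by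
        rw [div_mul_eq_mul_div, le_div_iff₀ (pow_pos hγ 2)]
        gcongr
      have h5 : 2 * Λ * (σ₀ ^ 2 + 2 * σ₁ ^ 2 * β * F) / γ ^ 2 = 2 * V / γ ^ 2 := by rw [hV]; ring
      rw [h5, add_mul]
      linarith
    have h := abs_real_inner_le_norm (gradient f (w t)) (g t - gradient f (w t))
    rw [inner_smul_left, conj_trivial, mul_pow, ← sq_abs ⟪gradient f (w t), _⟫_ℝ]
    calc (-(gradSqSum γ f w g t)⁻¹) ^ 2 * |⟪gradient f (w t), g t - gradient f (w t)⟫_ℝ| ^ 2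
        ≤ (-(gradSqSum γ f w g t)⁻¹) ^ 2 *
          (‖gradient f (w t)‖ * ‖g t - gradient f (w t)‖) ^ 2 := by gcongr
      _ = (‖g t - gradient f (w t)‖ ^ 2 * (gradSqSum γ f w g t)⁻¹) *
          (‖gradient f (w t)‖ ^ 2 / gradSqSum γ f w g t) := by
          rw [div_eq_mul_inv]; ring
      _ ≤ _ := by gcongr
  have h3 := Finset.sum_le_sum h1
  have h4 := Finset.sum_le_sum h2
  rw [Finset.sum_add_distrib, ← Finset.mul_sum] at h3
  rw [← Finset.mul_sum] at h4
  have h5 : (∑ t ∈ Finset.range n, ⟪(-(gradSqSum γ f w g t)⁻¹) • gradient f (w t),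
          g t - gradient f (w t)⟫_ℝ ^ 2) / (8 * R) ≤
      (∑ t ∈ Finset.range n, ‖gradient f (w t)‖ ^ 2 / gradSqSum γ f w g t) / 8 := by
    rw [div_le_div_iff₀ (by linarith) (by norm_num)]
    linarith
  linarith

/-- From ‖ξ‖² ≤ 2‖g‖² + 2‖∇f‖²; the constant is 2·(4/3)·16 < 43. -/
lemma sum_noise_sq_div_le (hγ : 0 < γ) {n : ℕ} {R : ℝ} (hR : 0 ≤ R) (hℓ : 0 ≤ ℓ) (hΛ : 0 ≤ Λ)
    (h1 : ∑ t ∈ Finset.range n, ‖g t‖ ^ 2 / gradSqSum γ f w g t ≤ R * ℓ)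
    (h2 : ∑ t ∈ Finset.range n, ‖gradient f (w t)‖ ^ 2 / gradSqSum γ f w g t ≤
      4 / 3 * R * (ℓ + 16 * Λ)) :
    ∑ t ∈ Finset.range n, ‖g t - gradient f (w t)‖ ^ 2 / gradSqSum γ f w g t ≤
      43 * (R * (ℓ + Λ)) := by
  have h3 : ∑ t ∈ Finset.range n, ‖g t - gradient f (w t)‖ ^ 2 / gradSqSum γ f w g t ≤
      ∑ t ∈ Finset.range n, (2 * (‖g t‖ ^ 2 / gradSqSum γ f w g t) +
        2 * (‖gradient f (w t)‖ ^ 2 / gradSqSum γ f w g t)) := by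
    refine Finset.sum_le_sum fun t ht => ?_
    have h0 := gradSqSum_pos (f := f) (w := w) (g := g) hγ t
    rw [← mul_div_assoc, ← mul_div_assoc, ← add_div]
    gcongr
    have h := norm_sub_le (g t) (gradient f (w t))
    nlinarith [pow_le_pow_left₀ (norm_nonneg _) h 2, sq_nonneg (‖g t‖ - ‖gradient f (w t)‖)]
  rw [Finset.sum_add_distrib, ← Finset.mul_sum, ← Finset.mul_sum] at h3
  have h4 := mul_nonneg hR hℓ
  have h5 := mul_nonneg hR hΛ
  linarith

/-- Expand the square and pass to the predictable step η/√`gradSqSum`. Convexity makes the ∇f part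
of the inner product favourable, so only noise remains. The replacement error ‖ξ‖‖g‖/(PQ) is split
by AM-GM with a free weight s. -/
lemma dist_sq_step_le (hη : 0 < η) (hγ : 0 < γ) (hc : ConvexOn ℝ Set.univ f)
    (hf : IsSmoothWith β f) (hmin : ∀ w, f wstar ≤ f w) {t : ℕ} {D s : ℝ} (hD : 0 ≤ D) (hs : 0 < s)
    (hw : w (t + 1) = w t - (η / √(sqSum γ g (t + 1))) • g t) (hx : ‖w t - wstar‖ ≤ D) :
    ‖w (t + 1) - wstar‖ ^ 2 - ‖w t - wstar‖ ^ 2 ≤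
      2 * ⟪(-(η / √(gradSqSum γ f w g t))) • (w t - wstar), g t - gradient f (w t)⟫_ℝ +
      D * η * (‖g t - gradient f (w t)‖ ^ 2 / gradSqSum γ f w g t / s +
        s * (‖g t‖ ^ 2 / sqSum γ g (t + 1))) + η ^ 2 * (‖g t‖ ^ 2 / sqSum γ g (t + 1)) := by
  have hS := sqSum_pos (g := g) hγ t
  have hS1 := sqSum_succ (γ := γ) (g := g) t
  set p := ‖gradient f (w t)‖ with hp
  set e := ‖g t - gradient f (w t)‖ with he
  have hcmp := abs_inv_sqrt_sub_inv_sqrt_le' hS (norm_nonneg (g t)) (norm_nonneg (gradient f (w t)))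
    (abs_norm_sub_norm_le (g t) (gradient f (w t)))
  rw [← hS1, ← hp, ← he] at hcmp
  have hQ2 : √(gradSqSum γ f w g t) ^ 2 = gradSqSum γ f w g t := Real.sq_sqrt (gradSqSum_pos hγ t).le
  have hQ0 : 0 < √(gradSqSum γ f w g t) := Real.sqrt_pos.2 (gradSqSum_pos hγ t)
  have hQdef : gradSqSum γ f w g t = sqSum γ g t + p ^ 2 := rfl
  rw [← hQdef] at hcmp
  rw [← hQ2]
  set P := √(sqSum γ g (t + 1)) with hP
  set Q := √(gradSqSum γ f w g t) with hQ
  have hP0 : 0 < P := Real.sqrt_pos.2 (sqSum_pos hγ _)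
  have hP2 : P ^ 2 = sqSum γ g (t + 1) := Real.sq_sqrt (sqSum_pos hγ _).le
  rw [← hP2, Real.sqrt_sq hQ0.le]
  have hsub : w (t + 1) - wstar = (w t - wstar) - (η / P) • g t := by rw [hw]; abel
  rw [hsub, norm_sub_sq_real, inner_smul_right, norm_smul, Real.norm_of_nonneg (by positivity),
    inner_smul_left, inner_sub_right, conj_trivial, real_inner_comm (gradient f (w t))]
  set x := w t - wstar with hxdef
  have hgrad : 0 ≤ ⟪gradient f (w t), x⟫_ℝ :=
    le_trans (sub_nonneg.2 (hmin _)) (sub_le_inner_gradient hc hf.1 (w t) wstar)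
  set c := ⟪x, g t⟫_ℝ with hcdef
  have hcabs : |c| ≤ D * ‖g t‖ := (abs_real_inner_le_norm _ _).trans (by gcongr)
  have h1 : 2 * ((1 / Q - 1 / P) * c) ≤ D * (e ^ 2 / Q ^ 2 / s + s * (‖g t‖ ^ 2 / P ^ 2)) := by
    calc 2 * ((1 / Q - 1 / P) * c) ≤ 2 * (|1 / Q - 1 / P| * |c|) := by
          rw [← abs_mul]; gcongr; exact le_abs_self _
      _ ≤ 2 * (e / (P * Q) * (D * ‖g t‖)) := by gcongr
      _ = D * (2 * ((e / Q) * (‖g t‖ / P))) := by field_simp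
      _ ≤ D * ((e / Q) ^ 2 / s + s * (‖g t‖ / P) ^ 2) := by
          gcongr
          have h := sq_nonneg (e / Q - s * (‖g t‖ / P))
          have e1 : (e / Q) ^ 2 / s + s * (‖g t‖ / P) ^ 2 - 2 * ((e / Q) * (‖g t‖ / P)) =
            (e / Q - s * (‖g t‖ / P)) ^ 2 / s := by field_simp; ring
          have : 0 ≤ (e / Q - s * (‖g t‖ / P)) ^ 2 / s := by positivity
          linarith
      _ = _ := by rw [div_pow, div_pow]
  have h2 := mul_le_mul_of_nonneg_left h1 hη.le
  have e1 : (η / P * ‖g t‖) ^ 2 = η ^ 2 * (‖g t‖ ^ 2 / P ^ 2) := by field_simp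
  have e2 : η * (2 * ((1 / Q - 1 / P) * c)) = 2 * (η / Q * c) - 2 * (η / P * c) := by ring
  have h3 : 0 ≤ η / Q * ⟪gradient f (w t), x⟫_ℝ := by positivity
  nlinarith

/-- The gap bound F is already available and makes the noise sum at most 43R(ℓ + Λ). Strong
induction then bounds the distance: every error term is linear in D times η√R(ℓ + Λ), or quadratic
in η, so half of D² absorbs the linear ones. -/
lemma norm_sub_le_of_martingale (hβ : 0 ≤ β) (hη : 0 < η) (hγ : 0 < γ) (hΛ : 1 ≤ Λ)
    (hc : ConvexOn ℝ Set.univ f)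
    (hf : IsSmoothWith β f) (hmin : ∀ w, f wstar ≤ f w) (hℓ : 0 ≤ ℓ)
    (hw : ∀ t, w (t + 1) = w t - (η / √(sqSum γ g (t + 1))) • g t)
    (hE : ∀ t < T, ‖g t - gradient f (w t)‖ ^ 2 ≤ Λ * noiseProxy σ₀ σ₁ f (w t))
    (hlog : ∀ n ≤ T, ∑ t ∈ Finset.range n, ‖g t‖ ^ 2 / sqSum γ g (t + 1) ≤ ℓ)
    (hF : ∀ t ≤ T, f (w t) - f wstar ≤ F) {D R : ℝ} (hD : 0 ≤ D)
    (hRdef : R = noiseRatio β σ₀ σ₁ γ Λ F)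
    (hMB : ∀ n ≤ T, (∀ t < n, f (w t) - f wstar ≤ F) →
      ∑ t ∈ Finset.range n, ⟪(-(gradSqSum γ f w g t)⁻¹) • gradient f (w t),
          g t - gradient f (w t)⟫_ℝ ≤
        (∑ t ∈ Finset.range n, ⟪(-(gradSqSum γ f w g t)⁻¹) • gradient f (w t),
          g t - gradient f (w t)⟫_ℝ ^ 2) / (8 * R) + 8 * R * Λ)
    (hMC : ∀ n ≤ T, (∀ t < n, f (w t) - f wstar ≤ F ∧ ‖w t - wstar‖ ≤ D) →
      ∑ t ∈ Finset.range n, ⟪(-(η / √(gradSqSum γ f w g t))) • (w t - wstar),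
          g t - gradient f (w t)⟫_ℝ ≤
        (∑ t ∈ Finset.range n, ⟪(-(η / √(gradSqSum γ f w g t))) • (w t - wstar),
          g t - gradient f (w t)⟫_ℝ ^ 2) / (2 * (η * D * √R)) + 2 * (η * D * √R) * Λ)
    (hDle : 2 * ‖w 0 - wstar‖ ^ 2 + 4000 * η ^ 2 * R * (ℓ + Λ) ^ 2 ≤ D ^ 2) :
    ∀ n ≤ T, ‖w n - wstar‖ ≤ D := by
  have hF0 : 0 ≤ F := (sub_nonneg.2 (hmin _)).trans (hF 0 (Nat.zero_le _))
  have hR : 2 ≤ R := by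
    rw [hRdef, noiseRatio]
    have : 0 ≤ 2 * Λ * (σ₀ ^ 2 + 2 * σ₁ ^ 2 * β * F) / γ ^ 2 := by positivity
    linarith
  have hE' : ∀ t < T, ‖g t - gradient f (w t)‖ ^ 2 ≤ Λ * (σ₀ ^ 2 + 2 * σ₁ ^ 2 * β * F) :=
    fun t ht => (hE t ht).trans (by
      gcongr
      exact noiseProxy_le hβ hf hmin (hF t ht.le))
  have hW : ∀ n ≤ T, ∑ t ∈ Finset.range n,
      ‖g t - gradient f (w t)‖ ^ 2 / gradSqSum γ f w g t ≤ 43 * (R * (ℓ + Λ)) := by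
    intro n hn
    have h := sum_gradient_sq_div_le (β := β) (σ₀ := σ₀) (σ₁ := σ₁) (F := F) (ℓ := ℓ)
      (Λ := Λ) (w := w) (g := g) (f := f) hγ (by rw [← hRdef]; linarith) (n := n)
      (fun t ht => hE' t (by omega))
      (hlog n hn) (by rw [← hRdef]; exact hMB n hn fun t ht => hF t (by omega))
    rw [← hRdef] at h
    exact sum_noise_sq_div_le hγ (by linarith) hℓ (by linarith) h.1 h.2
  intro n
  induction n using Nat.strong_induction_on with
  | _ n ih =>
  intro hn
  have hxt : ∀ t < n, ‖w t - wstar‖ ≤ D := fun t ht => ih t ht (by omega)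
  set r := √R with hr
  have hr0 : 0 < r := Real.sqrt_pos.2 (by linarith)
  have hr2 : r ^ 2 = R := Real.sq_sqrt (by linarith)
  -- The weight s = 6√R roughly balances 43R(ℓ + Λ)/s against s·ℓ.
  have hsum := Finset.sum_le_sum fun t (ht : t ∈ Finset.range n) =>
    dist_sq_step_le (w := w) (g := g) hη hγ hc hf hmin hD (by positivity : 0 < 6 * r) (hw t)
      (hxt t (Finset.mem_range.1 ht))
  rw [Finset.sum_range_sub (fun t => ‖w t - wstar‖ ^ 2), Finset.sum_add_distrib,
    Finset.sum_add_distrib, ← Finset.mul_sum, ← Finset.mul_sum, ← Finset.mul_sum,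
    Finset.sum_add_distrib, ← Finset.mul_sum, ← Finset.sum_div] at hsum
  have hmart := hMC n hn fun t ht => ⟨hF t (by omega), hxt t ht⟩
  have hWn := hW n hn
  have hln := hlog n hn
  have hquad : ∑ t ∈ Finset.range n, ⟪(-(η / √(gradSqSum γ f w g t))) • (w t - wstar),
          g t - gradient f (w t)⟫_ℝ ^ 2 ≤ η ^ 2 * D ^ 2 * ∑ t ∈ Finset.range n,
      ‖g t - gradient f (w t)‖ ^ 2 / gradSqSum γ f w g t := by
    rw [Finset.mul_sum]
    refine Finset.sum_le_sum fun t ht => ?_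
    have hQ2 : √(gradSqSum γ f w g t) ^ 2 = gradSqSum γ f w g t :=
      Real.sq_sqrt (gradSqSum_pos hγ t).le
    have hQ0 : 0 < √(gradSqSum γ f w g t) := Real.sqrt_pos.2 (gradSqSum_pos hγ t)
    rw [← hQ2, inner_smul_left, conj_trivial, mul_pow, ← sq_abs ⟪w t - wstar, _⟫_ℝ]
    have h := abs_real_inner_le_norm (w t - wstar) (g t - gradient f (w t))
    have h' := hxt t (Finset.mem_range.1 ht)
    rw [Real.sqrt_sq hQ0.le]
    calc _ ≤ (-(η / √(gradSqSum γ f w g t))) ^ 2 * (D * ‖g t - gradient f (w t)‖) ^ 2 := by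
          gcongr
          exact h.trans (by gcongr)
      _ = _ := by field_simp
  set q := ℓ + Λ with hq
  have hq1 : 1 ≤ q := by linarith
  have h1 : (∑ t ∈ Finset.range n, ⟪(-(η / √(gradSqSum γ f w g t))) • (w t - wstar),
          g t - gradient f (w t)⟫_ℝ ^ 2) / (2 * (η * D * r)) ≤ 43 / 2 * (η * D * r * q) := by
    refine div_le_of_le_mul₀ (by positivity) (by positivity) (hquad.trans ?_)
    calc _ ≤ η ^ 2 * D ^ 2 * (43 * (R * q)) := by gcongr
      _ = _ := by rw [← hr2]; ring
  have h2 : (∑ t ∈ Finset.range n, ‖g t - gradient f (w t)‖ ^ 2 / gradSqSum γ f w g t) / (6 * r)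
      ≤ 43 / 6 * (r * q) := by
    rw [div_le_iff₀ (by positivity)]
    calc _ ≤ _ := hWn
      _ = _ := by rw [← hr2]; ring
  have h3 : 6 * r * ∑ t ∈ Finset.range n, ‖g t‖ ^ 2 / sqSum γ g (t + 1) ≤ 6 * r * q := by
    gcongr
    linarith
  have h4 : D * η * ((∑ t ∈ Finset.range n, ‖g t - gradient f (w t)‖ ^ 2 / gradSqSum γ f w g t)
      / (6 * r) + 6 * r * ∑ t ∈ Finset.range n, ‖g t‖ ^ 2 / sqSum γ g (t + 1)) ≤
      D * η * (14 * (r * q)) := by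
    have : 0 ≤ r * q := by positivity
    gcongr
    linarith
  have h5 : η ^ 2 * ∑ t ∈ Finset.range n, ‖g t‖ ^ 2 / sqSum γ g (t + 1) ≤ η ^ 2 * (R * q ^ 2) := by
    gcongr
    nlinarith
  have h6 : 2 * (η * D * r) * Λ ≤ 2 * (η * D * r) * q := by
    gcongr
    linarith
  -- 61 = 43 + 4 + 14: twice the quadratic part of the martingale bound, twice its BΛ part, and the
  -- step replacement. The constant 1861 rounds up 61²/2.
  have h7 : 61 * (η * D * r * q) ≤ D ^ 2 / 2 + 1861 * (η ^ 2 * (R * q ^ 2)) := by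
    rw [← hr2]
    nlinarith [sq_nonneg (D - 61 * (η * r * q)), sq_nonneg (η * r * q)]
  have h8 : 0 ≤ η ^ 2 * (R * q ^ 2) := by positivity
  refine (sq_le_sq₀ (norm_nonneg _) hD).1 ?_
  nlinarith

/-- A is at most regret plus martingale. The regret is of order K·√(∑‖g‖²), and ∑‖g‖² is bounded
through A itself by self-bounding, so AM-GM leaves A/4. The quadratic part of the martingale leaves
another A/4, and solving for A doubles the rest. In B, the coefficient 8 makes the A-part of the
squared products at most B·A/4, while the first two terms also have to dominate the size of a single
increment. -/
lemma sum_gap_le_of_martingale (hβ : 0 ≤ β) (hη : 0 < η) (hγ : 0 < γ) (hΛ : 0 ≤ Λ)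
    (hc : ConvexOn ℝ Set.univ f)
    (hf : IsSmoothWith β f) (hmin : ∀ w, f wstar ≤ f w)
    (hσ₀ : 0 ≤ σ₀) (hσ₁ : 0 ≤ σ₁)
    (hw : ∀ t, w (t + 1) = w t - (η / √(sqSum γ g (t + 1))) • g t)
    (hE : ∀ t < T, ‖g t - gradient f (w t)‖ ^ 2 ≤ Λ * noiseProxy σ₀ σ₁ f (w t))
    {D B : ℝ} (hD : 0 ≤ D) (hx : ∀ t ≤ T, ‖w t - wstar‖ ≤ D)
    (hB : B = 3 * (D * √Λ * σ₀ * √T) + 2 * (√Λ * D ^ 2 * σ₁ * β) + 8 * (Λ * D ^ 2 * σ₁ ^ 2 * β))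
    (hM : ∑ t ∈ Finset.range T, ⟪-(w t - wstar), g t - gradient f (w t)⟫_ℝ ≤
        (∑ t ∈ Finset.range T, ⟪-(w t - wstar), g t - gradient f (w t)⟫_ℝ ^ 2) / B + B * Λ) :
    ∑ t ∈ Finset.range T, (f (w t) - f wstar) ≤ γ * ‖w 0 - wstar‖ ^ 2 / η +
      4 * ((D ^ 2 / η + η) * (√Λ * σ₀ * √T)) +
      8 * (β * (1 + Λ * σ₁ ^ 2) * (D ^ 2 / η + η) ^ 2) + 2 * (D * √Λ * σ₀ * √T) + 2 * (B * Λ) := by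
  set A := ∑ t ∈ Finset.range T, (f (w t) - f wstar) with hA
  have hA0 : 0 ≤ A := Finset.sum_nonneg fun t _ => sub_nonneg.2 (hmin _)
  set G := √(∑ t ∈ Finset.range T, ‖g t‖ ^ 2) with hG
  set K := D ^ 2 / η + η with hK
  have hK0 : 0 < K := by positivity
  obtain ⟨x, hxw⟩ : ∃ x : ℕ → Vec d, ∀ t, x t = w t - wstar := ⟨fun t => w t - wstar, fun _ => rfl⟩
  have hlin : A ≤ ∑ t ∈ Finset.range T, ⟪g t, x t⟫_ℝ +
      ∑ t ∈ Finset.range T, ⟪-(w t - wstar), g t - gradient f (w t)⟫_ℝ := by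
    rw [← Finset.sum_add_distrib]
    refine Finset.sum_le_sum fun t _ => ?_
    have h := sub_le_inner_gradient hc hf.1 (w t) wstar
    rw [hxw, inner_neg_left, real_inner_comm (g t - gradient f (w t)) (w t - wstar),
      inner_sub_left (g t)]
    linarith
  have hreg : ∑ t ∈ Finset.range T, ⟪g t, x t⟫_ℝ ≤ γ * ‖w 0 - wstar‖ ^ 2 / (2 * η) + K * G := by
    have h1 : ∀ t ∈ Finset.range T, ⟪g t, x t⟫_ℝ = 1 / (2 * η) *
        (√(sqSum γ g (t + 1)) * (‖x t‖ ^ 2 - ‖x (t + 1)‖ ^ 2)) +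
        η / 2 * (‖g t‖ ^ 2 / √(sqSum γ g (t + 1))) := by
      intro t _
      have hP0 : 0 < √(sqSum γ g (t + 1)) := Real.sqrt_pos.2 (sqSum_pos hγ _)
      have hsub : x (t + 1) = x t - (η / √(sqSum γ g (t + 1))) • g t := by
        rw [hxw, hxw, hw]; abel
      rw [hsub, norm_sub_sq_real (x t), inner_smul_right, norm_smul,
        Real.norm_of_nonneg (by positivity), real_inner_comm]
      field_simp
      ring
    rw [Finset.sum_congr rfl h1, Finset.sum_add_distrib, ← Finset.mul_sum, ← Finset.mul_sum]
    have h2 := sum_sqrt_sqSum_mul_sub_le (g := g) hγ (X := fun t => ‖x t‖ ^ 2) (D := D ^ 2) (n := T)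
      (fun t ht => by rw [hxw]; exact pow_le_pow_left₀ (norm_nonneg _) (hx t ht) 2)
    have h3 := sum_sq_div_sqrt_sqSum_le (g := g) hγ T
    have h4 := sqrt_sqSum_sub_le (g := g) hγ T
    rw [← hG] at h4
    have h5 : 0 ≤ √(sqSum γ g T) * ‖x T‖ ^ 2 := by positivity
    have h6 : (√(sqSum γ g T) - γ) * D ^ 2 ≤ G * D ^ 2 := by gcongr
    have h7 : 1 / (2 * η) * ∑ t ∈ Finset.range T,
        (√(sqSum γ g (t + 1)) * (‖x t‖ ^ 2 - ‖x (t + 1)‖ ^ 2)) ≤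
        1 / (2 * η) * (γ * ‖x 0‖ ^ 2 + G * D ^ 2) := by
      gcongr
      linarith
    have h8 : η / 2 * ∑ t ∈ Finset.range T, ‖g t‖ ^ 2 / √(sqSum γ g (t + 1)) ≤ η / 2 * (2 * G) := by
      gcongr
      linarith
    have h9 : 1 / (2 * η) * (γ * ‖x 0‖ ^ 2 + G * D ^ 2) + η / 2 * (2 * G) =
        γ * ‖w 0 - wstar‖ ^ 2 / (2 * η) + (D ^ 2 / η / 2 + η) * G := by
      rw [hxw]; field_simp; ring
    have h10 : (D ^ 2 / η / 2 + η) * G ≤ K * G := by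
      have : 0 ≤ D ^ 2 / η := by positivity
      gcongr
      linarith
    linarith
  have hv : ∀ t, noiseProxy σ₀ σ₁ f (w t) ≤ σ₀ ^ 2 + 2 * σ₁ ^ 2 * β * (f (w t) - f wstar) :=
    fun t => noiseProxy_le hβ hf hmin le_rfl
  have hEt : ∀ t ∈ Finset.range T, ‖g t - gradient f (w t)‖ ^ 2 ≤
      Λ * σ₀ ^ 2 + 2 * (Λ * σ₁ ^ 2 * β) * (f (w t) - f wstar) := by
    intro t ht
    refine (hE t (Finset.mem_range.1 ht)).trans ?_
    have := mul_le_mul_of_nonneg_left (hv t) hΛ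
    linarith
  have hGA : G ≤ √(4 * β * (1 + Λ * σ₁ ^ 2) * A) + 2 * (√Λ * σ₀ * √T) := by
    have h1 : ∑ t ∈ Finset.range T, ‖g t‖ ^ 2 ≤ ∑ t ∈ Finset.range T,
        (2 * (Λ * σ₀ ^ 2) + 4 * β * (1 + Λ * σ₁ ^ 2) * (f (w t) - f wstar)) := by
      refine Finset.sum_le_sum fun t ht => ?_
      have h2 := norm_sq_le_two_mul (hEt t ht)
      have h3 := hf.norm_gradient_sq_le hβ hmin (w t)
      linarith
    rw [Finset.sum_add_distrib, Finset.sum_const, Finset.card_range, nsmul_eq_mul,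
      ← Finset.mul_sum] at h1
    have h4 : √(T * (2 * (Λ * σ₀ ^ 2))) ≤ 2 * (√Λ * σ₀ * √T) := by
      rw [Real.sqrt_le_iff]
      refine ⟨by positivity, ?_⟩
      rw [mul_pow, mul_pow, mul_pow, Real.sq_sqrt hΛ, Real.sq_sqrt (Nat.cast_nonneg T)]
      have : 0 ≤ Λ * σ₀ ^ 2 * T := by positivity
      linarith
    have h5 : √(T * (2 * (Λ * σ₀ ^ 2)) + 4 * β * (1 + Λ * σ₁ ^ 2) * A) ≤
        √(T * (2 * (Λ * σ₀ ^ 2))) + √(4 * β * (1 + Λ * σ₁ ^ 2) * A) :=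
      sqrt_add_le (by positivity) (by positivity)
    have h6 := Real.sqrt_le_sqrt h1
    rw [← hG] at h6
    linarith
  have hKG : K * √(4 * β * (1 + Λ * σ₁ ^ 2) * A) ≤ A / 4 + 4 * (β * (1 + Λ * σ₁ ^ 2) * K ^ 2) := by
    have h1 := Real.sq_sqrt (by positivity : 0 ≤ 4 * β * (1 + Λ * σ₁ ^ 2) * A)
    have h2 := Real.sqrt_nonneg (4 * β * (1 + Λ * σ₁ ^ 2) * A)
    set y := √(4 * β * (1 + Λ * σ₁ ^ 2) * A) with hy
    refine (sq_le_sq₀ (by positivity) (by positivity)).1 ?_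
    rw [mul_pow, h1]
    nlinarith [sq_nonneg (A / 4 - 4 * (β * (1 + Λ * σ₁ ^ 2) * K ^ 2))]
  have hZ : (∑ t ∈ Finset.range T, ⟪-(w t - wstar), g t - gradient f (w t)⟫_ℝ ^ 2) / B ≤
      D * √Λ * σ₀ * √T + A / 4 := by
    have hB0 : 0 ≤ B := by rw [hB]; positivity
    refine div_le_of_le_mul₀ hB0 (by positivity) ?_
    have h1 : ∑ t ∈ Finset.range T, ⟪-(w t - wstar), g t - gradient f (w t)⟫_ℝ ^ 2 ≤
        ∑ t ∈ Finset.range T,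
          (D ^ 2 * (Λ * σ₀ ^ 2) + D ^ 2 * (2 * (Λ * σ₁ ^ 2 * β)) * (f (w t) - f wstar)) := by
      refine Finset.sum_le_sum fun t ht => ?_
      have h := abs_real_inner_le_norm (-(w t - wstar)) (g t - gradient f (w t))
      have h' := hx t (Finset.mem_range.1 ht).le
      rw [norm_neg] at h
      calc _ = |⟪-(w t - wstar), g t - gradient f (w t)⟫_ℝ| ^ 2 := (sq_abs _).symm
        _ ≤ (D * ‖g t - gradient f (w t)‖) ^ 2 := by
            gcongr
            exact h.trans (by gcongr)
        _ = D ^ 2 * ‖g t - gradient f (w t)‖ ^ 2 := by ring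
        _ ≤ D ^ 2 * (Λ * σ₀ ^ 2 + 2 * (Λ * σ₁ ^ 2 * β) * (f (w t) - f wstar)) := by
            gcongr
            exact hEt t ht
        _ = _ := by ring
    rw [Finset.sum_add_distrib, Finset.sum_const, Finset.card_range, nsmul_eq_mul,
      ← Finset.mul_sum] at h1
    refine h1.trans ?_
    set y := D * √Λ * σ₀ * √T with hy
    have hy0 : 0 ≤ y := by positivity
    have e1 : T * (D ^ 2 * (Λ * σ₀ ^ 2)) = y ^ 2 := by
      rw [hy, mul_pow, mul_pow, mul_pow, Real.sq_sqrt hΛ, Real.sq_sqrt (Nat.cast_nonneg T)]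
      ring
    rw [e1, hB]
    have h2 : 0 ≤ √Λ * D ^ 2 * σ₁ * β := by positivity
    have h3 : 0 ≤ Λ * D ^ 2 * σ₁ ^ 2 * β := by positivity
    nlinarith [mul_nonneg hy0 h2, mul_nonneg hy0 h3, mul_nonneg hA0 h2, mul_nonneg hA0 h3,
      mul_nonneg hy0 hA0, sq_nonneg y]
  have hKG' := mul_le_mul_of_nonneg_left hGA hK0.le
  have e : γ * ‖w 0 - wstar‖ ^ 2 / (2 * η) = γ * ‖w 0 - wstar‖ ^ 2 / η / 2 := by
    field_simp
  rw [e] at hreg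
  linarith

end Path

/-! ### A priori growth of S_t and the logarithmic factor. -/

section Growth

variable {d : ℕ} {f : Vec d → ℝ} {β σ₀ σ₁ η γ Λ : ℝ} {T : ℕ} {w g : ℕ → Vec d}
  {wstar : Vec d}

/-- A step never exceeds η in length, since ‖g_t‖² is part of its own normalization. -/
lemma norm_gradient_le_add_mul (hβ : 0 ≤ β) (hη : 0 < η) (hγ : 0 < γ) (hf : IsSmoothWith β f)
    (hw : ∀ t, w (t + 1) = w t - (η / √(sqSum γ g (t + 1))) • g t) (t : ℕ) :
    ‖gradient f (w t)‖ ≤ ‖gradient f (w 0)‖ + β * η * t := by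
  induction t with
  | zero => simp
  | succ t ih =>
    have hP0 : 0 < √(sqSum γ g (t + 1)) := Real.sqrt_pos.2 (sqSum_pos hγ _)
    have h1 : ‖w (t + 1) - w t‖ ≤ η := by
      rw [hw, sub_sub_cancel_left, norm_neg, norm_smul, Real.norm_of_nonneg (by positivity),
        div_mul_eq_mul_div, div_le_iff₀ hP0]
      gcongr
      apply Real.le_sqrt_of_sq_le
      rw [sqSum_succ]
      linarith [sqSum_pos (g := g) hγ t]
    have h2 := (hf.2 (w (t + 1)) (w t)).trans (mul_le_mul_of_nonneg_left h1 hβ)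
    have h3 : ‖gradient f (w (t + 1))‖ ≤
        ‖gradient f (w (t + 1)) - gradient f (w t)‖ + ‖gradient f (w t)‖ := by
      simpa using norm_add_le (gradient f (w (t + 1)) - gradient f (w t)) (gradient f (w t))
    push_cast
    linarith

lemma sqSum_le_of_noise (hβ : 0 ≤ β) (hη : 0 < η) (hγ : 0 < γ) (hΛ : 0 ≤ Λ)
    (hf : IsSmoothWith β f) (hmin : ∀ w, f wstar ≤ f w)
    (hw : ∀ t, w (t + 1) = w t - (η / √(sqSum γ g (t + 1))) • g t)
    (hE : ∀ t < T, ‖g t - gradient f (w t)‖ ^ 2 ≤ Λ * noiseProxy σ₀ σ₁ f (w t)) {n : ℕ}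
    (hn : n ≤ T) :
    sqSum γ g n ≤ γ ^ 2 + T * (2 * (1 + Λ * σ₁ ^ 2) *
      (4 * (β * (f (w 0) - f wstar)) + 2 * (η ^ 2 * β ^ 2 * T ^ 2)) + 2 * Λ * σ₀ ^ 2) := by
  have h0 : 0 ≤ f (w 0) - f wstar := sub_nonneg.2 (hmin _)
  have key : ∀ t < T, ‖g t‖ ^ 2 ≤ 2 * (1 + Λ * σ₁ ^ 2) *
      (4 * (β * (f (w 0) - f wstar)) + 2 * (η ^ 2 * β ^ 2 * T ^ 2)) + 2 * Λ * σ₀ ^ 2 := by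
    intro t ht
    have h1 := norm_sq_le_two_mul (hE t ht)
    have h2 := norm_gradient_le_add_mul hβ hη hγ hf hw t
    have h3 := hf.norm_gradient_sq_le hβ hmin (w 0)
    have h4 : ‖gradient f (w t)‖ ^ 2 ≤
        4 * (β * (f (w 0) - f wstar)) + 2 * (η ^ 2 * β ^ 2 * T ^ 2) := by
      have h5 := pow_le_pow_left₀ (norm_nonneg _) h2 2
      have h6 : (β * η * t) ^ 2 ≤ η ^ 2 * β ^ 2 * (T : ℝ) ^ 2 := by
        rw [mul_pow, mul_pow, mul_comm (β ^ 2)]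
        gcongr
      nlinarith [sq_nonneg (‖gradient f (w 0)‖ - β * η * t)]
    unfold noiseProxy at h1
    have h7 : 2 * (1 + Λ * σ₁ ^ 2) * ‖gradient f (w t)‖ ^ 2 ≤ 2 * (1 + Λ * σ₁ ^ 2) *
      (4 * (β * (f (w 0) - f wstar)) + 2 * (η ^ 2 * β ^ 2 * T ^ 2)) := by gcongr
    linarith
  unfold sqSum
  gcongr
  calc ∑ s ∈ Finset.range n, ‖g s‖ ^ 2 ≤ ∑ s ∈ Finset.range T, ‖g s‖ ^ 2 :=
        Finset.sum_le_sum_of_subset_of_nonneg (by simpa using hn) fun _ _ _ => by positivity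
    _ ≤ ∑ s ∈ Finset.range T, _ := Finset.sum_le_sum fun t ht => key t (Finset.mem_range.1 ht)
    _ = _ := by rw [Finset.sum_const, Finset.card_range, nsmul_eq_mul]

lemma logb_two_le_self {y : ℝ} (hy : 0 < y) : Real.logb 2 y ≤ y := by
  have h2 := Real.log_two_gt_d9
  have h2' := Real.log_two_lt_d9
  rw [← Real.log_div_log, div_le_iff₀ (by linarith)]
  have h := Real.log_le_sub_one_of_pos (half_pos hy)
  rw [Real.log_div hy.ne' two_ne_zero] at h
  nlinarith

lemma log_le_logb_two {y : ℝ} (hy : 1 ≤ y) : Real.log y ≤ Real.logb 2 y := by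
  have h2 := Real.log_two_gt_d9
  have h2' := Real.log_two_lt_d9
  rw [← Real.log_div_log, le_div_iff₀ (by linarith)]
  nlinarith [Real.log_nonneg hy]

lemma add_poly_le_pow_seven {y A : ℝ} (hy : 4 ≤ y) (hA : 1 ≤ A) :
    1 + 32 * y ^ 4 * A ^ 2 + 8 * y ^ 2 * A ≤ (y * A) ^ 7 := by
  have c1 : 1 ≤ y ^ 4 * A ^ 2 := one_le_mul_of_one_le_of_one_le
    (one_le_pow₀ (by linarith)) (one_le_pow₀ hA)
  have c2 : y ^ 2 * A ≤ y ^ 4 * A ^ 2 :=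
    mul_le_mul (pow_le_pow_right₀ (by linarith) (by norm_num))
      (le_self_pow₀ hA (by norm_num)) (by linarith) (by positivity)
  have c3 : 64 * (y ^ 4 * A ^ 2) ≤ (y * A) ^ 7 := by
    have d1 : (64 : ℝ) ≤ y ^ 3 := by
      have := pow_le_pow_left₀ (by norm_num) hy 3
      linarith
    have d2 : A ^ 2 ≤ A ^ 7 := pow_le_pow_right₀ hA (by norm_num)
    calc 64 * (y ^ 4 * A ^ 2) ≤ y ^ 3 * (y ^ 4 * A ^ 7) :=
          mul_le_mul d1 (mul_le_mul_of_nonneg_left d2 (by positivity)) (by positivity)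
            (by positivity)
      _ = _ := by ring
  linarith

/-- With y = T/δ and A the second factor inside the logarithm of L, the growth bound is polynomial
in y and A. Using y ≥ 4 to absorb constants, it is at most (yA)^7, hence the factor 7. -/
lemma log_div_le_of_le {Δ δ S : ℝ} (hβ : 0 ≤ β) (hγ : 0 < γ)
    (hΔ : 0 ≤ Δ) (hT : 1 ≤ T) (hδ : 0 < δ) (hδ' : δ < 1 / 4)
    (hΛ : Λ = 4 * Real.logb 2 (T / δ)) (hS0 : γ ^ 2 ≤ S)
    (hS : S ≤ γ ^ 2 + T * (2 * (1 + Λ * σ₁ ^ 2) *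
      (4 * (β * Δ) + 2 * (η ^ 2 * β ^ 2 * T ^ 2)) + 2 * Λ * σ₀ ^ 2)) :
    Real.log (S / γ ^ 2) ≤ 7 * logFactor β σ₀ σ₁ η γ δ Δ T := by
  unfold logFactor
  set y : ℝ := T / δ with hy
  have hT' : (1 : ℝ) ≤ T := by exact_mod_cast hT
  have hy4 : 4 ≤ y := by rw [hy, le_div_iff₀ hδ]; linarith
  have hTy : (T : ℝ) ≤ y := by rw [hy, le_div_iff₀ hδ]; nlinarith
  have hγ2 : 0 < γ ^ 2 := by positivity
  set a := (σ₀ ^ 2 + η ^ 2 * β ^ 2 + β * Δ) / γ ^ 2 with ha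
  have ha0 : 0 ≤ a := by positivity
  set A := 1 + σ₁ ^ 2 + a with hA
  have hA1 : 1 ≤ A := by nlinarith [sq_nonneg σ₁]
  have hΛy : Λ ≤ 4 * y := by rw [hΛ]; linarith [logb_two_le_self (by linarith : 0 < y)]
  have hΛ0 : 0 ≤ Λ := by rw [hΛ]; linarith [Real.logb_nonneg one_lt_two (by linarith : 1 ≤ y)]
  have haγ : σ₀ ^ 2 + η ^ 2 * β ^ 2 + β * Δ = a * γ ^ 2 := by
    rw [ha, div_mul_cancel₀ _ hγ2.ne']
  have hy2 : 0 ≤ y ^ 2 := by positivity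
  have b1 : 1 + Λ * σ₁ ^ 2 ≤ 4 * y * A := by
    have := mul_le_mul_of_nonneg_right hΛy (sq_nonneg σ₁)
    rw [hA]
    nlinarith
  have b2 : 4 * (β * Δ) + 2 * (η ^ 2 * β ^ 2 * T ^ 2) ≤ 4 * y ^ 2 * A * γ ^ 2 := by
    have h1 : (T : ℝ) ^ 2 ≤ y ^ 2 := by gcongr
    have h2 : η ^ 2 * β ^ 2 * (T : ℝ) ^ 2 ≤ η ^ 2 * β ^ 2 * y ^ 2 := by gcongr
    have h3 : β * Δ ≤ β * Δ * y ^ 2 := le_mul_of_one_le_right (by positivity) (by nlinarith)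
    have h4 : 0 ≤ η ^ 2 * β ^ 2 * y ^ 2 := by positivity
    have h5 : 0 ≤ σ₀ ^ 2 * y ^ 2 := by positivity
    calc 4 * (β * Δ) + 2 * (η ^ 2 * β ^ 2 * T ^ 2) ≤
        4 * y ^ 2 * (σ₀ ^ 2 + η ^ 2 * β ^ 2 + β * Δ) := by linarith
      _ = 4 * y ^ 2 * a * γ ^ 2 := by rw [haγ]; ring
      _ ≤ 4 * y ^ 2 * A * γ ^ 2 := by gcongr; rw [hA]; linarith [sq_nonneg σ₁]
  have b3 : 2 * Λ * σ₀ ^ 2 ≤ 8 * y * A * γ ^ 2 := by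
    have h1 : σ₀ ^ 2 ≤ A * γ ^ 2 := by
      have : 0 ≤ β * Δ := by positivity
      have : 0 ≤ η ^ 2 * β ^ 2 := by positivity
      have : 0 ≤ (1 + σ₁ ^ 2) * γ ^ 2 := by positivity
      rw [hA, add_mul, ← haγ]
      linarith
    calc 2 * Λ * σ₀ ^ 2 ≤ 2 * (4 * y) * (A * γ ^ 2) := by gcongr
      _ = _ := by ring
  have hβΔ : 0 ≤ 4 * (β * Δ) + 2 * (η ^ 2 * β ^ 2 * T ^ 2) := by positivity
  have hle : S / γ ^ 2 ≤ (y * A) ^ 7 := by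
    rw [div_le_iff₀ hγ2]
    calc S ≤ γ ^ 2 + y * (2 * (4 * y * A) * (4 * y ^ 2 * A * γ ^ 2) + 8 * y * A * γ ^ 2) := by
          refine hS.trans ?_
          gcongr
      _ = (1 + 32 * y ^ 4 * A ^ 2 + 8 * y ^ 2 * A) * γ ^ 2 := by ring
      _ ≤ (y * A) ^ 7 * γ ^ 2 := by
          gcongr
          exact add_poly_le_pow_seven hy4 hA1
  have h1 : 1 ≤ S / γ ^ 2 := by rwa [le_div_iff₀ hγ2, one_mul]
  have hyA : 1 ≤ y * A := one_le_mul_of_one_le_of_one_le (by linarith) hA1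
  calc Real.log (S / γ ^ 2) ≤ Real.log ((y * A) ^ 7) := Real.log_le_log (by linarith) hle
    _ = 7 * Real.log (y * A) := by rw [Real.log_pow]; norm_num
    _ ≤ _ := by gcongr; exact log_le_logb_two hyA

end Growth

/-! ### The self-normalized martingale inequality. -/

section Concentration

variable {Ω : Type*} {_ : MeasurableSpace Ω} {d : ℕ} {μ : Measure Ω} {f : Vec d → ℝ}
  {κ : Kernel (Vec d) (Vec d)} {β σ₀ σ₁ η γ Λ : ℝ} {w₁ : Vec d} {T : ℕ} {g : ℕ → Ω → Vec d}

/-- The direction is divided by B and set to zero outside the past-determined set C t, so the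
increment bound holds on every history. On trajectories that stay in C before time n and have no
large noise, neither the switch nor the truncation is active. The exceptional set b does not depend
on n, which is what the inductions on time need. -/
lemma IsAdaSGDRun.exists_measure_le_forall_sum_inner_le [IsProbabilityMeasure μ] [IsMarkovKernel κ]
    (hrun : IsAdaSGDRun μ κ η γ w₁ T g) (hf : IsSmoothWith β f)
    (ho : IsGradientOracle f κ) (hs : IsSubGaussianAffine σ₀ σ₁ κ) (hΛ : 1 ≤ Λ)
    (hT : T * (3 / 2 * Real.exp (-Λ)) ≤ 1) {u : ℕ → (ℕ → Vec d) → Vec d}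
    {C : ℕ → Set (ℕ → Vec d)} {B : ℝ} (hB : 0 ≤ B)
    (hu : ∀ t, Measurable (u t)) (hpast : ∀ t h, u t (pastOf t h) = u t h)
    (hC : ∀ t, MeasurableSet (C t)) (hCpast : ∀ t h, pastOf t h ∈ C t ↔ h ∈ C t)
    (hbd : ∀ t, ∀ h ∈ C t,
      ‖u t h‖ * √(Λ * noiseProxy σ₀ σ₁ f (adaSGD η γ w₁ h t)) ≤ B / 2) :
    ∃ b : Set Ω, μ b ≤ ENNReal.ofReal ((T + 1) * (3 * Real.exp (-Λ))) ∧ ∀ ω ∉ b,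
      (∀ t < T, ‖g t ω - gradient f (adaSGD η γ w₁ (fun s => g s ω) t)‖ ^ 2 ≤
        Λ * noiseProxy σ₀ σ₁ f (adaSGD η γ w₁ (fun s => g s ω) t)) →
      ∀ n ≤ T, (∀ t < n, (fun s => g s ω) ∈ C t) →
        ∑ t ∈ Finset.range n, ⟪u t (fun s => g s ω),
          g t ω - gradient f (adaSGD η γ w₁ (fun s => g s ω) t)⟫_ℝ ≤
        (∑ t ∈ Finset.range n, ⟪u t (fun s => g s ω),
          g t ω - gradient f (adaSGD η γ w₁ (fun s => g s ω) t)⟫_ℝ ^ 2) / B + B * Λ := by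
  classical
  have h1 := hrun.measure_exists_martingale_le hf ho hs hΛ hT
    (u := fun t h => if h ∈ C t then B⁻¹ • u t h else 0)
    (fun t => Measurable.ite (hC t) ((hu t).const_smul B⁻¹) measurable_const)
    (fun t h => by simp only [hCpast, hpast])
    (fun t h => by
      split_ifs with hh
      · rw [norm_smul, Real.norm_of_nonneg (inv_nonneg.2 hB), mul_assoc]
        rcases hB.eq_or_lt with rfl | hB0
        · norm_num
        · rw [inv_mul_le_iff₀ hB0]
          linarith [hbd t h hh]
      · norm_num)
  refine ⟨_, h1, fun ω hω hE n hn hCn => le_of_not_gt fun hlt => hω ⟨n, hn, ?_⟩⟩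
  set z : ℕ → ℝ := fun t => ⟪u t (fun s => g s ω),
    g t ω - gradient f (adaSGD η γ w₁ (fun s => g s ω) t)⟫_ℝ with hz
  -- If B = 0, the size condition forces all inner products to vanish and the claim reads 0 ≤ 0.
  have hB0 : 0 < B := by
    refine hB.lt_of_ne fun h0 => ?_
    have hz0 : ∀ t ∈ Finset.range n, z t = 0 := by
      intro t ht
      have ht := Finset.mem_range.1 ht
      have h2 := hbd t _ (hCn t ht)
      have h3 := abs_real_inner_le_norm (u t (fun s => g s ω))
        (g t ω - gradient f (adaSGD η γ w₁ (fun s => g s ω) t))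
      have h4 : ‖g t ω - gradient f (adaSGD η γ w₁ (fun s => g s ω) t)‖ ≤
        √(Λ * noiseProxy σ₀ σ₁ f (adaSGD η γ w₁ (fun s => g s ω) t)) :=
        Real.le_sqrt_of_sq_le (hE t (by omega))
      have h5 := h3.trans ((mul_le_mul_of_nonneg_left h4 (norm_nonneg _)).trans h2)
      rw [← h0, zero_div] at h5
      exact abs_nonpos_iff.1 h5
    have h6 : ∑ t ∈ Finset.range n, z t = 0 := Finset.sum_eq_zero hz0
    rw [h6, ← h0] at hlt
    simp at hlt
  have hZ : ∀ t ∈ Finset.range n,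
      truncInner Λ (noiseProxy σ₀ σ₁ f (adaSGD η γ w₁ (fun s => g s ω) t))
        (if (fun s => g s ω) ∈ C t then B⁻¹ • u t (fun s => g s ω) else 0)
        (gradient f (adaSGD η γ w₁ (fun s => g s ω) t)) (g t ω) = B⁻¹ * z t := by
    intro t ht
    have ht := Finset.mem_range.1 ht
    rw [truncInner, if_pos (hE t (by omega)), if_pos (hCn t ht), inner_smul_left, conj_trivial]
  have e : ∑ t ∈ Finset.range n,
      (truncInner Λ (noiseProxy σ₀ σ₁ f (adaSGD η γ w₁ (fun s => g s ω) t))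
        (if (fun s => g s ω) ∈ C t then B⁻¹ • u t (fun s => g s ω) else 0)
        (gradient f (adaSGD η γ w₁ (fun s => g s ω) t)) (g t ω) -
      truncInner Λ (noiseProxy σ₀ σ₁ f (adaSGD η γ w₁ (fun s => g s ω) t))
        (if (fun s => g s ω) ∈ C t then B⁻¹ • u t (fun s => g s ω) else 0)
        (gradient f (adaSGD η γ w₁ (fun s => g s ω) t)) (g t ω) ^ 2) =
      B⁻¹ * (∑ t ∈ Finset.range n, z t - (∑ t ∈ Finset.range n, z t ^ 2) / B) := by
    rw [Finset.sum_div, ← Finset.sum_sub_distrib, Finset.mul_sum]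
    refine Finset.sum_congr rfl fun t ht => ?_
    rw [hZ t ht]
    field_simp
  rw [e, lt_inv_mul_iff₀ hB0]
  linarith

end Concentration

/-! ### Measurability and size of the four directions. -/

section Directions

variable {d : ℕ} {f : Vec d → ℝ} {β σ₀ σ₁ η γ Λ F : ℝ} {w₁ wstar : Vec d}

lemma sqSum_pastOf (t : ℕ) (h : ℕ → Vec d) : sqSum γ (pastOf t h) t = sqSum γ h t := by
  unfold sqSum
  rw [Finset.sum_congr rfl fun s hs => by rw [pastOf_apply (Finset.mem_range.1 hs)]]

lemma measurable_sqSum (γ : ℝ) (t : ℕ) : Measurable fun h : ℕ → Vec d => sqSum γ h t := by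
  unfold sqSum
  exact measurable_const.add
    (Finset.measurable_fun_sum _ fun s _ => (measurable_pi_apply s).norm.pow_const 2)

lemma IsSmoothWith.measurable_gradient_adaSGD (hf : IsSmoothWith β f) (t : ℕ) :
    Measurable fun h : ℕ → Vec d => gradient f (adaSGD η γ w₁ h t) :=
  hf.continuous_gradient.measurable.comp (measurable_adaSGD η γ w₁ t)

lemma measurable_proxyStep (hf : IsSmoothWith β f) (t : ℕ) :
    Measurable fun h : ℕ → Vec d => proxyStep η γ Λ σ₀ σ₁ f (adaSGD η γ w₁ h) h t := by
  have hg := hf.measurable_gradient_adaSGD (η := η) (γ := γ) (w₁ := w₁) t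
  unfold proxyStep noiseProxy
  exact measurable_const.div ((measurable_sqSum γ t).add ((hg.norm.pow_const 2).add
    ((measurable_const.add ((hg.norm.pow_const 2).const_mul _)).const_mul _))).sqrt

lemma measurable_gradSqSum (hf : IsSmoothWith β f) (t : ℕ) :
    Measurable fun h : ℕ → Vec d => gradSqSum γ f (adaSGD η γ w₁ h) h t := by
  have hg := hf.measurable_gradient_adaSGD (η := η) (γ := γ) (w₁ := w₁) t
  exact (measurable_sqSum γ t).add (hg.norm.pow_const 2)

lemma proxyStep_pastOf (t : ℕ) (h : ℕ → Vec d) :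
    proxyStep η γ Λ σ₀ σ₁ f (adaSGD η γ w₁ (pastOf t h)) (pastOf t h) t =
      proxyStep η γ Λ σ₀ σ₁ f (adaSGD η γ w₁ h) h t := by
  unfold proxyStep
  rw [sqSum_pastOf, adaSGD_pastOf]

lemma gradSqSum_pastOf (t : ℕ) (h : ℕ → Vec d) :
    gradSqSum γ f (adaSGD η γ w₁ (pastOf t h)) (pastOf t h) t =
      gradSqSum γ f (adaSGD η γ w₁ h) h t := by
  unfold gradSqSum
  rw [sqSum_pastOf, adaSGD_pastOf]

lemma measurableSet_gap_le (hf : IsSmoothWith β f) (t : ℕ) :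
    MeasurableSet {h : ℕ → Vec d | f (adaSGD η γ w₁ h t) - f wstar ≤ F} :=
  measurableSet_le ((hf.1.continuous.measurable.comp (measurable_adaSGD η γ w₁ t)).sub_const _)
    measurable_const

lemma measurableSet_dist_le (D : ℝ) (t : ℕ) :
    MeasurableSet {h : ℕ → Vec d | ‖adaSGD η γ w₁ h t - wstar‖ ≤ D} :=
  measurableSet_le ((measurable_adaSGD η γ w₁ t).sub_const _).norm measurable_const

variable {w g : ℕ → Vec d} {t : ℕ}

lemma norm_proxyStep_smul_gradient_mul_le (hη : 0 < η) (hγ : 0 < γ) (hβ : 0 ≤ β) (hΛ : 0 ≤ Λ)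
    (hf : IsSmoothWith β f) (hmin : ∀ w, f wstar ≤ f w) (hF : f (w t) - f wstar ≤ F) {N : ℝ}
    (hN : Λ * (σ₀ ^ 2 + 2 * σ₁ ^ 2 * β * F) ≤ N) :
    ‖(-proxyStep η γ Λ σ₀ σ₁ f w g t) • gradient f (w t)‖ * √(Λ * noiseProxy σ₀ σ₁ f (w t)) ≤
      η * √N := by
  have hS := sqSum_pos (g := g) hγ t
  have hv := mul_nonneg hΛ (noiseProxy_nonneg (σ₀ := σ₀) (σ₁ := σ₁) (f := f) (w t))
  unfold proxyStep
  set Q := √(sqSum γ g t + (‖gradient f (w t)‖ ^ 2 + Λ * noiseProxy σ₀ σ₁ f (w t))) with hQ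
  have hQ0 : 0 < Q := Real.sqrt_pos.2 (by positivity)
  rw [norm_smul, norm_neg, Real.norm_of_nonneg (by positivity)]
  have h1 : ‖gradient f (w t)‖ ≤ Q := Real.le_sqrt_of_sq_le (by linarith)
  have h2 : √(Λ * noiseProxy σ₀ σ₁ f (w t)) ≤ √N := by
    apply Real.sqrt_le_sqrt
    refine le_trans ?_ hN
    gcongr
    exact noiseProxy_le hβ hf hmin hF
  calc η / Q * ‖gradient f (w t)‖ * √(Λ * noiseProxy σ₀ σ₁ f (w t)) ≤ η / Q * Q * √N := by gcongr
    _ = η * √N := by rw [div_mul_cancel₀ _ hQ0.ne']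

lemma noiseProxy_le_noiseRatio_mul (hγ : 0 < γ) (hβ : 0 ≤ β) (hΛ : 0 ≤ Λ)
    (hf : IsSmoothWith β f) (hmin : ∀ w, f wstar ≤ f w) (hF : f (w t) - f wstar ≤ F) :
    Λ * noiseProxy σ₀ σ₁ f (w t) ≤ noiseRatio β σ₀ σ₁ γ Λ F * gradSqSum γ f w g t := by
  have h1 := mul_le_mul_of_nonneg_left
    (noiseProxy_le (σ₀ := σ₀) (σ₁ := σ₁) hβ hf hmin hF) hΛ
  have h0 := h1.trans' (mul_nonneg hΛ (noiseProxy_nonneg _))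
  have h2 := sq_le_sqSum (γ := γ) (g := g) t
  have hS : γ ^ 2 ≤ gradSqSum γ f w g t := by
    unfold gradSqSum; linarith [sq_nonneg ‖gradient f (w t)‖]
  unfold noiseRatio
  set V := Λ * (σ₀ ^ 2 + 2 * σ₁ ^ 2 * β * F) with hV
  have h4 : 2 * V ≤ 2 * V / γ ^ 2 * gradSqSum γ f w g t := by
    rw [div_mul_eq_mul_div, le_div_iff₀ (pow_pos hγ 2)]
    gcongr
  have h5 : 2 * Λ * (σ₀ ^ 2 + 2 * σ₁ ^ 2 * β * F) / γ ^ 2 = 2 * V / γ ^ 2 := by rw [hV]; ring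
  rw [h5, add_mul]
  have := gradSqSum_pos (f := f) (w := w) (g := g) hγ t
  linarith

lemma norm_inv_gradSqSum_smul_gradient_mul_le (hγ : 0 < γ) (hβ : 0 ≤ β) (hΛ : 0 ≤ Λ)
    (hf : IsSmoothWith β f) (hmin : ∀ w, f wstar ≤ f w) (hF : f (w t) - f wstar ≤ F) {R : ℝ}
    (hR : R = noiseRatio β σ₀ σ₁ γ Λ F) (hR1 : 1 ≤ R) :
    ‖(-(gradSqSum γ f w g t)⁻¹) • gradient f (w t)‖ * √(Λ * noiseProxy σ₀ σ₁ f (w t)) ≤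
      4 * R := by
  have h0 := gradSqSum_pos (f := f) (w := w) (g := g) hγ t
  have hv := mul_nonneg hΛ (noiseProxy_nonneg (σ₀ := σ₀) (σ₁ := σ₁) (f := f) (w t))
  have h1 := noiseProxy_le_noiseRatio_mul (σ₀ := σ₀) (σ₁ := σ₁) (g := g) hγ hβ hΛ hf hmin hF
  rw [← hR] at h1
  have h2 := Real.sq_sqrt hv
  have h3 : ‖gradient f (w t)‖ ^ 2 ≤ gradSqSum γ f w g t := by
    unfold gradSqSum; linarith [sqSum_pos (g := g) hγ t]
  rw [norm_smul, norm_neg, Real.norm_of_nonneg (by positivity), mul_assoc, inv_mul_le_iff₀ h0]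
  nlinarith [sq_nonneg (‖gradient f (w t)‖ - √(Λ * noiseProxy σ₀ σ₁ f (w t))),
    mul_le_mul_of_nonneg_right hR1 h0.le]

lemma norm_step_smul_sub_mul_le (hη : 0 < η) (hγ : 0 < γ) (hβ : 0 ≤ β) (hΛ : 0 ≤ Λ)
    (hf : IsSmoothWith β f) (hmin : ∀ w, f wstar ≤ f w) (hF : f (w t) - f wstar ≤ F) {R D : ℝ}
    (hD : ‖w t - wstar‖ ≤ D) (hR : R = noiseRatio β σ₀ σ₁ γ Λ F) (hR1 : 1 ≤ R) :
    ‖(-(η / √(gradSqSum γ f w g t))) • (w t - wstar)‖ * √(Λ * noiseProxy σ₀ σ₁ f (w t)) ≤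
      η * D * √R := by
  have h0 := gradSqSum_pos (f := f) (w := w) (g := g) hγ t
  have h1 := noiseProxy_le_noiseRatio_mul (σ₀ := σ₀) (σ₁ := σ₁) (g := g) hγ hβ hΛ hf hmin hF
  rw [← hR] at h1
  have h2 := Real.sqrt_le_sqrt h1
  rw [Real.sqrt_mul (by linarith : 0 ≤ R)] at h2
  have hQ0 := Real.sqrt_pos.2 h0
  rw [norm_smul, norm_neg, Real.norm_of_nonneg (by positivity)]
  calc _ ≤ η / √(gradSqSum γ f w g t) * D * (√R * √(gradSqSum γ f w g t)) := by
        have := (norm_nonneg _).trans hD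
        gcongr
    _ = _ := by field_simp

lemma norm_sub_mul_sqrt_noiseProxy_le (hβ : 0 ≤ β) (hσ₀ : 0 ≤ σ₀) (hσ₁ : 0 ≤ σ₁) (hΛ : 0 ≤ Λ)
    (hf : IsSmoothWith β f) (hmin : ∀ w, f wstar ≤ f w) {x : Vec d} {D : ℝ}
    (hD : ‖x - wstar‖ ≤ D) :
    ‖-(x - wstar)‖ * √(Λ * noiseProxy σ₀ σ₁ f x) ≤ D * (√Λ * (σ₀ + σ₁ * (β * D))) := by
  have hD0 := (norm_nonneg _).trans hD
  have h1 : ‖gradient f x‖ ≤ β * D := (hf.norm_gradient_le hmin x).trans (by gcongr)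
  rw [norm_neg, Real.sqrt_mul hΛ]
  gcongr
  rw [Real.sqrt_le_iff]
  refine ⟨by positivity, ?_⟩
  unfold noiseProxy
  have h2 : σ₁ * ‖gradient f x‖ ≤ σ₁ * (β * D) := by gcongr
  have h3 := pow_le_pow_left₀ (by positivity) h2 2
  have h4 : 0 ≤ σ₀ * (σ₁ * (β * D)) := by positivity
  nlinarith

end Directions

/-! ### Closing the numerical constants. -/

section Bounds

variable {β σ₀ σ₁ η γ L lg Δ F : ℝ}

/-- F occurs on both sides, but on the left only under a square root: AM-GM turns that term into F/2
plus a multiple of L²η²β(1 + 4Lσ₁²). The definition of F leaves room for the rest. -/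
lemma gap_bound_closes (hβ : 0 ≤ β) (hσ₀ : 0 ≤ σ₀) (hη : 0 < η) (hL : 1 ≤ L)
    (hlg : 0 ≤ lg) (hlgL : lg ≤ L) (hΔ : 0 ≤ Δ)
    (hF : F = gapBound (10 ^ 7) 5 L β σ₀ σ₁ η Δ) :
    Δ + η * √(2 * β * F + 4 * lg * (σ₀ ^ 2 + 2 * σ₁ ^ 2 * β * F)) * (7 * L + 2 * (4 * lg)) +
      β / 2 * η ^ 2 * (7 * L) ≤ F := by
  have hF0 : 0 ≤ F := by rw [hF, gapBound]; positivity
  have p2 : L ^ 2 ≤ L ^ 5 := pow_le_pow_right₀ hL (by norm_num)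
  have p3 : L ^ 3 ≤ L ^ 5 := pow_le_pow_right₀ hL (by norm_num)
  have p1 : L ≤ L ^ 5 := le_self_pow₀ hL (by norm_num)
  have p0 : 1 ≤ L ^ 5 := one_le_pow₀ hL
  have s1 : √(2 * β * F + 4 * lg * (σ₀ ^ 2 + 2 * σ₁ ^ 2 * β * F)) ≤
      2 * L * σ₀ + √(2 * β * F * (1 + 4 * L * σ₁ ^ 2)) := by
    have h1 : 2 * β * F + 4 * lg * (σ₀ ^ 2 + 2 * σ₁ ^ 2 * β * F) ≤
        (2 * L * σ₀) ^ 2 + 2 * β * F * (1 + 4 * L * σ₁ ^ 2) := by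
      have h2 : lg * (σ₁ ^ 2 * β * F) ≤ L * (σ₁ ^ 2 * β * F) := by gcongr
      have h3 : lg * σ₀ ^ 2 ≤ L ^ 2 * σ₀ ^ 2 := by gcongr; nlinarith
      linarith
    refine (Real.sqrt_le_sqrt h1).trans ((sqrt_add_le (by positivity) (by positivity)).trans ?_)
    rw [Real.sqrt_sq (by positivity)]
  have s2 := Real.sq_sqrt (by positivity : 0 ≤ 2 * β * F * (1 + 4 * L * σ₁ ^ 2))
  set y := √(2 * β * F * (1 + 4 * L * σ₁ ^ 2)) with hy
  have hy0 : 0 ≤ y := Real.sqrt_nonneg _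
  have s3 : 15 * (η * L * y) ≤ F / 2 + 225 * (L ^ 2 * η ^ 2 * β * (1 + 4 * L * σ₁ ^ 2)) := by
    refine (sq_le_sq₀ (by positivity) (by positivity)).1 ?_
    rw [show (15 * (η * L * y)) ^ 2 = 225 * (η * L) ^ 2 * y ^ 2 by ring, s2]
    nlinarith [sq_nonneg (F / 2 - 225 * (L ^ 2 * η ^ 2 * β * (1 + 4 * L * σ₁ ^ 2)))]
  have s4 : η * √(2 * β * F + 4 * lg * (σ₀ ^ 2 + 2 * σ₁ ^ 2 * β * F)) * (7 * L + 2 * (4 * lg)) ≤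
      η * (2 * L * σ₀ + y) * (15 * L) := by
    gcongr
    linarith
  have q1 : L ^ 2 * (η * σ₀) ≤ L ^ 5 * (η * σ₀) := by gcongr
  have q2 : L ^ 2 * (η ^ 2 * β) ≤ L ^ 5 * (η ^ 2 * β) := by gcongr
  have q3 : L ^ 3 * (η ^ 2 * β * σ₁ ^ 2) ≤ L ^ 5 * (η ^ 2 * β * σ₁ ^ 2) := by gcongr
  have q4 : L * (η ^ 2 * β) ≤ L ^ 5 * (η ^ 2 * β) := by gcongr
  have q5 : Δ ≤ L ^ 5 * Δ := le_mul_of_one_le_left hΔ p0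
  have r1 : 0 ≤ L ^ 5 * (η * σ₀) := by positivity
  have r2 : 0 ≤ L ^ 5 * (η ^ 2 * β) := by positivity
  have r3 : 0 ≤ L ^ 5 * (η ^ 2 * β * σ₁ ^ 2) := by positivity
  have r5 : 0 ≤ L ^ 5 * Δ := by positivity
  have eF : F = 10 ^ 7 * (L ^ 5 * Δ + L ^ 5 * (η * σ₀) + L ^ 5 * (η ^ 2 * β * σ₁ ^ 2) +
      L ^ 5 * (η ^ 2 * β)) := by rw [hF, gapBound]; ring
  linarith

/-- Here the final constants are decided: lg² gives L², R gives L and (ℓ + Λ)² gives L², hence the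
exponent 5; 4000·16·11² = 7744000 is below 10^7. The extra lg² is needed in `average_bound_le`. The
σ₁² and γ⁻⁴ terms of `distSqBound` are only slack. -/
lemma dist_bound_le (hβ : 0 ≤ β) (hL : 1 ≤ L) (hlg : 0 ≤ lg) (hlgL : lg ≤ L) {d₁ : ℝ}
    (hF : 0 ≤ F) :
    lg ^ 2 * (2 * d₁ ^ 2 + 4000 * η ^ 2 * noiseRatio β σ₀ σ₁ γ (4 * lg) F *
      (7 * L + 4 * lg) ^ 2) ≤ distSqBound (10 ^ 7) 5 L β σ₀ σ₁ η γ d₁ F := by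
  have p2 : L ^ 2 ≤ L ^ 5 := pow_le_pow_right₀ hL (by norm_num)
  have p4 : L ^ 4 ≤ L ^ 5 := pow_le_pow_right₀ hL (by norm_num)
  unfold noiseRatio distSqBound
  set Y := (σ₀ ^ 2 + β * σ₁ ^ 2 * F) / γ ^ 2 with hY
  have hY0 : 0 ≤ Y := by positivity
  have h1 : 2 * (4 * lg) * (σ₀ ^ 2 + 2 * σ₁ ^ 2 * β * F) / γ ^ 2 ≤ 16 * L * Y := by
    have h2 : 0 ≤ σ₀ ^ 2 := by positivity
    have h3 : 0 ≤ β * σ₁ ^ 2 * F := by positivity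
    have h4 : 2 * (4 * lg) * (σ₀ ^ 2 + 2 * σ₁ ^ 2 * β * F) ≤
        2 * (4 * L) * (2 * (σ₀ ^ 2 + β * σ₁ ^ 2 * F)) := by
      gcongr
      linarith
    rw [hY, ← mul_div_assoc]
    refine div_le_div_of_nonneg_right (h4.trans (le_of_eq (by ring))) (by positivity)
  have h0 : 0 ≤ 2 * (4 * lg) * (σ₀ ^ 2 + 2 * σ₁ ^ 2 * β * F) / γ ^ 2 := by positivity
  calc _ ≤ L ^ 2 * (2 * d₁ ^ 2 + 4000 * η ^ 2 * (2 + 16 * L * Y) * (7 * L + 4 * L) ^ 2) := by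
        gcongr
    _ = 2 * (L ^ 2 * d₁ ^ 2) + 968000 * (L ^ 4 * η ^ 2) + 7744000 * (L ^ 5 * (η ^ 2 * Y)) := by
        ring
    _ ≤ 2 * (L ^ 5 * d₁ ^ 2) + 968000 * (L ^ 5 * η ^ 2) + 7744000 * (L ^ 5 * (η ^ 2 * Y)) := by
        gcongr
    _ ≤ 10 ^ 7 * (L ^ 5 * d₁ ^ 2 + L ^ 5 * η ^ 2 + L ^ 5 * (η ^ 2 * Y) +
          L ^ 5 * (η ^ 2 * (σ₁ ^ 2 + (σ₀ ^ 4 + β ^ 2 * σ₁ ^ 4 * F ^ 2) / γ ^ 4))) := by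
        have r1 : 0 ≤ L ^ 5 * d₁ ^ 2 := by positivity
        have r2 : 0 ≤ L ^ 5 * η ^ 2 := by positivity
        have r3 : 0 ≤ L ^ 5 * (η ^ 2 * Y) := by positivity
        have r4 : 0 ≤ L ^ 5 * (η ^ 2 * (σ₁ ^ 2 + (σ₀ ^ 4 + β ^ 2 * σ₁ ^ 4 * F ^ 2) / γ ^ 4)) := by
          positivity
        linarith
    _ = _ := by ring

/-- The term BΛ carries more logarithms than the target allows. They are hidden in the radius: the
iterates are within D', and lg·D' ≤ D. The terms with log(1/δ) in the target are only slack. -/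
lemma average_bound_le (hβ : 0 ≤ β) (hσ₀ : 0 ≤ σ₀) (hη : 0 < η) (hγ : 0 < γ)
    {T lδ D D' B A d₁ : ℝ} (hT : 0 < T) (hlg : 1 ≤ lg) (hlδ : 0 ≤ lδ) (hD : 0 ≤ D)
    (hD' : 0 ≤ D') (hDD : lg * D' ≤ D)
    (hB : B = 3 * (D' * √(4 * lg) * σ₀ * √T) + 2 * (√(4 * lg) * D' ^ 2 * σ₁ * β) +
      8 * (4 * lg * D' ^ 2 * σ₁ ^ 2 * β))
    (hA : A ≤ γ * d₁ ^ 2 / η + 4 * ((D' ^ 2 / η + η) * (√(4 * lg) * σ₀ * √T)) +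
      8 * (β * (1 + 4 * lg * σ₁ ^ 2) * (D' ^ 2 / η + η) ^ 2) + 2 * (D' * √(4 * lg) * σ₀ * √T) +
      2 * (B * (4 * lg))) :
    A / T ≤ 10 ^ 7 * ((D ^ 2 / η + η) + D * √lδ) * (σ₀ * √lg / √T)
      + 10 ^ 7 * (γ * d₁ ^ 2 / η + β * (1 + σ₁ ^ 2 * lg) * (D ^ 2 / η + η) ^ 2
        + β * σ₁ ^ 2 * D ^ 2 * lδ * lg) * (1 / T) := by
  have e4 : √(4 * lg) = 2 * √lg := by
    rw [Real.sqrt_mul (by norm_num), show (4 : ℝ) = 2 ^ 2 by norm_num, Real.sqrt_sq (by norm_num)]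
  have hDle : D' ≤ D := (le_mul_of_one_le_left hD' hlg).trans hDD
  set K := D ^ 2 / η + η with hK
  have hK0 : 0 < K := by positivity
  have hK' : D' ^ 2 / η + η ≤ K := by rw [hK]; gcongr
  have hDK : 2 * D ≤ K := by
    rw [hK]
    have : 2 * D * η ≤ D ^ 2 + η ^ 2 := by nlinarith [sq_nonneg (D - η)]
    rw [div_add' _ _ _ hη.ne', le_div_iff₀ hη]
    linarith
  -- AM-GM gives 2D ≤ D²/η + η = K, so D² terms can be charged to K².
  have hlD : lg * D' ^ 2 * lg ≤ K ^ 2 / 4 := by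
    have h1 := pow_le_pow_left₀ (by positivity) hDD 2
    have h2 := pow_le_pow_left₀ (by positivity) hDK 2
    linarith
  have hlg0 : 0 ≤ √lg := Real.sqrt_nonneg _
  have hlg2 : √lg ^ 2 = lg := Real.sq_sqrt (by linarith)
  have hsT : √T ^ 2 = T := Real.sq_sqrt hT.le
  have hsT0 : 0 < √T := Real.sqrt_pos.2 hT
  set z := σ₀ * √lg * √T with hz
  have hz0 : 0 ≤ z := by positivity
  have hA2 : A ≤ γ * d₁ ^ 2 / η + 34 * (K * z) + 100 * (β * (1 + σ₁ ^ 2 * lg) * K ^ 2) := by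
    have t1 : 4 * ((D' ^ 2 / η + η) * (√(4 * lg) * σ₀ * √T)) ≤ 8 * (K * z) := by
      rw [e4, show 4 * ((D' ^ 2 / η + η) * (2 * √lg * σ₀ * √T)) = 8 * ((D' ^ 2 / η + η) * z) by
        rw [hz]; ring]
      gcongr
    have t2 : 8 * (β * (1 + 4 * lg * σ₁ ^ 2) * (D' ^ 2 / η + η) ^ 2) ≤
        32 * (β * (1 + σ₁ ^ 2 * lg) * K ^ 2) := by
      have h1 : 1 + 4 * lg * σ₁ ^ 2 ≤ 4 * (1 + σ₁ ^ 2 * lg) := by linarith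
      calc _ ≤ 8 * (β * (4 * (1 + σ₁ ^ 2 * lg)) * K ^ 2) := by gcongr
        _ = _ := by ring
    have t3 : 2 * (D' * √(4 * lg) * σ₀ * √T) ≤ 2 * (K * z) := by
      rw [e4, show 2 * (D' * (2 * √lg) * σ₀ * √T) = 2 * (2 * D' * z) by rw [hz]; ring]
      gcongr
      linarith
    have t4 : 2 * (B * (4 * lg)) ≤ 24 * (K * z) + 68 * (β * (1 + σ₁ ^ 2 * lg) * K ^ 2) := by
      have h1 : 2 * (B * (4 * lg)) = 24 * (2 * (lg * D') * z) +
          8 * (β * (4 * (√lg * σ₁) + 32 * (lg * σ₁ ^ 2)) * (lg * D' ^ 2)) := by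
        rw [hB, e4, hz]; ring
      have h2 : 4 * (√lg * σ₁) + 32 * (lg * σ₁ ^ 2) ≤ 34 * (1 + σ₁ ^ 2 * lg) := by
        nlinarith [sq_nonneg (√lg * σ₁ - 1)]
      have h3 : lg * D' ^ 2 ≤ K ^ 2 / 4 :=
        (le_mul_of_one_le_right (by positivity) hlg).trans hlD
      rw [h1]
      have h4 : 24 * (2 * (lg * D') * z) ≤ 24 * (K * z) := by
        gcongr
        linarith
      have h5 : 8 * (β * (4 * (√lg * σ₁) + 32 * (lg * σ₁ ^ 2)) * (lg * D' ^ 2)) ≤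
          8 * (β * (34 * (1 + σ₁ ^ 2 * lg)) * (K ^ 2 / 4)) := by gcongr
      linarith
    linarith
  have e1 : z / T = σ₀ * √lg / √T := by
    rw [hz, div_eq_div_iff hT.ne' hsT0.ne', mul_assoc, ← sq, hsT]
  have hy0 : 0 ≤ σ₀ * √lg / √T := by positivity
  have w1 : 0 ≤ D * √lδ := by positivity
  have w2 : 0 ≤ β * σ₁ ^ 2 * D ^ 2 * lδ * lg := by positivity
  have w3 : 0 ≤ γ * d₁ ^ 2 / η := by positivity
  have w4 : 0 ≤ β * (1 + σ₁ ^ 2 * lg) * K ^ 2 := by positivity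
  calc A / T ≤ (γ * d₁ ^ 2 / η + 34 * (K * z) + 100 * (β * (1 + σ₁ ^ 2 * lg) * K ^ 2)) / T := by
        gcongr
    _ = 34 * K * (z / T) + (γ * d₁ ^ 2 / η + 100 * (β * (1 + σ₁ ^ 2 * lg) * K ^ 2)) * (1 / T) := by
        field_simp
        ring
    _ ≤ _ := by
        rw [e1]
        refine add_le_add (mul_le_mul_of_nonneg_right (by linarith) hy0)
          (mul_le_mul_of_nonneg_right (by linarith) (by positivity))

end Bounds

/-! ### Averaging, the failure probability, and the main theorem. -/

lemma map_average_sub_le {d : ℕ} {f : Vec d → ℝ} (hc : ConvexOn ℝ Set.univ f) {T : ℕ} (hT : 1 ≤ T)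
    (w : ℕ → Vec d) (c : ℝ) :
    f ((1 / (T : ℝ)) • ∑ t ∈ Finset.range T, w t) - c ≤
      (∑ t ∈ Finset.range T, (f (w t) - c)) / T := by
  have hT0 : (0 : ℝ) < T := by exact_mod_cast hT
  have h := hc.map_sum_le (t := Finset.range T) (w := fun _ => 1 / (T : ℝ)) (p := w)
    (fun _ _ => by positivity) (by simp [hT0.ne']) (fun _ _ => Set.mem_univ _)
  rw [← Finset.smul_sum, ← Finset.smul_sum] at h
  rw [Finset.sum_sub_distrib, Finset.sum_const, Finset.card_range, nsmul_eq_mul, sub_div,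
    mul_div_cancel_left₀ _ hT0.ne']
  simpa [div_eq_inv_mul] using h

lemma exp_neg_four_mul_logb_le {y : ℝ} (hy : 4 ≤ y) :
    Real.exp (-(4 * Real.logb 2 y)) ≤ 1 / (64 * y) := by
  have hy0 : 0 < y := by linarith
  have h1 := log_le_logb_two (by linarith : 1 ≤ y)
  calc Real.exp (-(4 * Real.logb 2 y)) ≤ Real.exp (-(4 * Real.log y)) := by gcongr
    _ = (y ^ 4)⁻¹ := by
        rw [Real.exp_neg, show (4 : ℝ) * Real.log y = ((4 : ℕ) : ℝ) * Real.log y by norm_num,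
          Real.exp_nat_mul, Real.exp_log hy0]
    _ ≤ (64 * y)⁻¹ := by
        gcongr
        have := pow_le_pow_left₀ (by norm_num) hy 3
        nlinarith
    _ = _ := (one_div _).symm

lemma one_sub_le_measureReal_of_forall_notMem {Ω : Type*} {_ : MeasurableSpace Ω} {μ : Measure Ω}
    [IsProbabilityMeasure μ] {S b : Set Ω} {ε : ℝ} (hε : 0 ≤ ε) (hb : μ b ≤ ENNReal.ofReal ε)
    (h : ∀ ω ∉ b, ω ∈ S) : 1 - ε ≤ μ.real S := by
  have h1 : μ.real Set.univ ≤ μ.real S + μ.real b :=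
    (measureReal_mono fun ω _ => or_iff_not_imp_right.2 (h ω)).trans (measureReal_union_le _ _)
  have h2 : μ.real b ≤ ε := ENNReal.toReal_le_of_le_ofReal hε hb
  rw [probReal_univ] at h1
  linarith

theorem theorem4 :
    ∃ (c : ℝ) (k : ℕ), 0 < c ∧
      ∀ (d : ℕ) (f : Vec d → ℝ) (κ : Kernel (Vec d) (Vec d)) (β σ₀ σ₁ η γ δ : ℝ) (T : ℕ)
        (w₁ wstar : Vec d) (Ω : Type*) (_ : MeasurableSpace Ω) (μ : Measure Ω)
        (g : ℕ → Ω → Vec d) (F D L : ℝ),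
        IsProbabilityMeasure μ → IsMarkovKernel κ →
        0 ≤ β → 0 ≤ σ₀ → 0 ≤ σ₁ → 0 < η → 0 < γ → 0 < δ → δ < 1 / 4 → 1 ≤ T →
        ConvexOn ℝ Set.univ f → IsSmoothWith β f → (∀ w, f wstar ≤ f w) →
        IsGradientOracle f κ → IsSubGaussianAffine σ₀ σ₁ κ →
        IsAdaSGDRun μ κ η γ w₁ T g →
        L = logFactor β σ₀ σ₁ η γ δ (f w₁ - f wstar) T →
        F = gapBound c k L β σ₀ σ₁ η (f w₁ - f wstar) →
        D = Real.sqrt (distSqBound c k L β σ₀ σ₁ η γ ‖w₁ - wstar‖ F) →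
        1 - 2 * δ ≤ μ.real {ω |
          f ((1 / (T : ℝ)) • ∑ t ∈ Finset.range T, adaSGD η γ w₁ (fun s => g s ω) t) - f wstar ≤
              c * ((D ^ 2 / η + η) + D * Real.sqrt (Real.logb 2 (1 / δ))) *
                (σ₀ * Real.sqrt (Real.logb 2 (T / δ)) / Real.sqrt T)
              + c * (γ * ‖w₁ - wstar‖ ^ 2 / η
                  + β * (1 + σ₁ ^ 2 * Real.logb 2 (T / δ)) * (D ^ 2 / η + η) ^ 2
                  + β * σ₁ ^ 2 * D ^ 2 * Real.logb 2 (1 / δ) * Real.logb 2 (T / δ)) * (1 / T)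
          ∧ ∀ t ≤ T, ‖adaSGD η γ w₁ (fun s => g s ω) t - wstar‖ ≤ D} := by
  refine ⟨10 ^ 7, 5, by norm_num, ?_⟩
  intro d f κ β σ₀ σ₁ η γ δ T w₁ wstar Ω _ μ g F D L _ _ hβ hσ₀ hσ₁ hη hγ hδ hδ4 hT hc hf hmin ho hs
    hrun hL hF hD
  have hTR : (1 : ℝ) ≤ T := by exact_mod_cast hT
  have hΔ : 0 ≤ f w₁ - f wstar := sub_nonneg.2 (hmin _)
  set lg := Real.logb 2 (T / δ) with hlg
  have hy4 : 4 ≤ T / δ := by rw [le_div_iff₀ hδ]; linarith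
  have hlg1 : 1 ≤ lg := by
    rw [hlg, Real.le_logb_iff_rpow_le one_lt_two (by linarith), Real.rpow_one]
    linarith
  have hlgL : lg ≤ L := by
    rw [hL, logFactor, hlg]
    refine Real.logb_le_logb_of_le one_lt_two (by linarith) (le_mul_of_one_le_right (by linarith) ?_)
    have : 0 ≤ (σ₀ ^ 2 + η ^ 2 * β ^ 2 + β * (f w₁ - f wstar)) / γ ^ 2 := by positivity
    linarith [sq_nonneg σ₁]
  have hL1 : 1 ≤ L := hlg1.trans hlgL
  have hlδ : 0 ≤ Real.logb 2 (1 / δ) :=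
    Real.logb_nonneg one_lt_two (by rw [le_div_iff₀ hδ]; linarith)
  have hF0 : 0 ≤ F := by rw [hF, gapBound]; positivity
  have hD0 : 0 ≤ D := by rw [hD]; positivity
  -- The factor 4 gives e^{-Λ} ≤ (T/δ)⁻⁴ ≤ δ/(64T), since T/δ ≥ 4.
  set Λ := 4 * lg with hΛ
  have hΛ1 : 1 ≤ Λ := by linarith
  have hΛ0 : 0 ≤ Λ := by linarith
  have hexp : Real.exp (-Λ) ≤ 1 / (64 * (T / δ)) := exp_neg_four_mul_logb_le hy4
  have hexpT : T * Real.exp (-Λ) ≤ δ / 64 := by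
    calc T * Real.exp (-Λ) ≤ T * (1 / (64 * (T / δ))) := by gcongr
      _ = δ / 64 := by field_simp
  have hexp1 : T * (3 / 2 * Real.exp (-Λ)) ≤ 1 := by linarith
  set N := 2 * β * F + Λ * (σ₀ ^ 2 + 2 * σ₁ ^ 2 * β * F) with hN
  obtain ⟨R, hR⟩ : ∃ R, R = noiseRatio β σ₀ σ₁ γ Λ F := ⟨_, rfl⟩
  have hR1 : 1 ≤ R := by
    rw [hR, noiseRatio]
    have : 0 ≤ 2 * Λ * (σ₀ ^ 2 + 2 * σ₁ ^ 2 * β * F) / γ ^ 2 := by positivity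
    linarith
  obtain ⟨E, hE⟩ : ∃ E, E = √(2 * ‖w₁ - wstar‖ ^ 2 + 4000 * η ^ 2 * R * (7 * L + Λ) ^ 2) :=
    ⟨_, rfl⟩
  have hE0 : 0 ≤ E := by rw [hE]; positivity
  have hE2 : E ^ 2 = 2 * ‖w₁ - wstar‖ ^ 2 + 4000 * η ^ 2 * R * (7 * L + Λ) ^ 2 := by
    rw [hE, Real.sq_sqrt (by positivity)]
  have hED : lg * E ≤ D := by
    rw [hD]
    apply Real.le_sqrt_of_sq_le
    rw [mul_pow, hE2, hR]
    exact dist_bound_le hβ hL1 (by linarith) hlgL hF0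
  have hEleD : E ≤ D := (le_mul_of_one_le_left hE0 hlg1).trans hED
  obtain ⟨B, hB⟩ : ∃ B, B = 3 * (E * √Λ * σ₀ * √T) + 2 * (√Λ * E ^ 2 * σ₁ * β) +
    8 * (Λ * E ^ 2 * σ₁ ^ 2 * β) := ⟨_, rfl⟩
  have hB0 : 0 ≤ B := by rw [hB]; positivity
  have mGrad := fun t => hf.measurable_gradient_adaSGD (η := η) (γ := γ) (w₁ := w₁) t
  have mDist := fun t => (measurable_adaSGD (d := d) η γ w₁ t).sub_const wstar
  have hNoise := hrun.measure_exists_noise_le hf ho hs (Λ := Λ) (by linarith)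
  -- The four directions serve, in order, the function gap, the gradient sum, the distance and the
  -- regret. Each B is at least twice the largest possible increment on its set C.
  obtain ⟨bA, hMA, hmA⟩ := hrun.exists_measure_le_forall_sum_inner_le hf ho hs hΛ1 hexp1 (B := 2 * (η * √N))
    (u := fun t h => (-proxyStep η γ Λ σ₀ σ₁ f (adaSGD η γ w₁ h) h t) •
      gradient f (adaSGD η γ w₁ h t))
    (C := fun t => {h | f (adaSGD η γ w₁ h t) - f wstar ≤ F}) (by positivity)
    (fun t => (measurable_proxyStep hf t).neg.smul (mGrad t))
    (fun t h => by rw [proxyStep_pastOf, adaSGD_pastOf])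
    (fun t => measurableSet_gap_le hf t)
    (fun t h => by simp only [Set.mem_ofPred_eq, adaSGD_pastOf])
    (fun t h hh => (norm_proxyStep_smul_gradient_mul_le hη hγ hβ hΛ0 hf hmin hh
      (N := N) (by rw [hN]; linarith [mul_nonneg hβ hF0])).trans (by linarith))
  obtain ⟨bB, hMB, hmB⟩ := hrun.exists_measure_le_forall_sum_inner_le hf ho hs hΛ1 hexp1 (B := 8 * R)
    (u := fun t h => (-(gradSqSum γ f (adaSGD η γ w₁ h) h t)⁻¹) •
      gradient f (adaSGD η γ w₁ h t))
    (C := fun t => {h | f (adaSGD η γ w₁ h t) - f wstar ≤ F}) (by positivity)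
    (fun t => (measurable_gradSqSum hf t).inv.neg.smul (mGrad t))
    (fun t h => by rw [gradSqSum_pastOf, adaSGD_pastOf])
    (fun t => measurableSet_gap_le hf t)
    (fun t h => by simp only [Set.mem_ofPred_eq, adaSGD_pastOf])
    (fun t h hh => (norm_inv_gradSqSum_smul_gradient_mul_le hγ hβ hΛ0 hf hmin hh hR hR1).trans
      (by linarith))
  obtain ⟨bC, hMC, hmC⟩ := hrun.exists_measure_le_forall_sum_inner_le hf ho hs hΛ1 hexp1 (B := 2 * (η * E * √R))
    (u := fun t h => (-(η / √(gradSqSum γ f (adaSGD η γ w₁ h) h t))) •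
      (adaSGD η γ w₁ h t - wstar))
    (C := fun t => {h | f (adaSGD η γ w₁ h t) - f wstar ≤ F} ∩
      {h | ‖adaSGD η γ w₁ h t - wstar‖ ≤ E}) (by positivity)
    (fun t => (measurable_const.div (measurable_gradSqSum hf t).sqrt).neg.smul (mDist t))
    (fun t h => by rw [gradSqSum_pastOf, adaSGD_pastOf])
    (fun t => (measurableSet_gap_le hf t).inter (measurableSet_dist_le E t))
    (fun t h => by simp only [Set.mem_inter_iff, Set.mem_ofPred_eq, adaSGD_pastOf])
    (fun t h hh => (norm_step_smul_sub_mul_le hη hγ hβ hΛ0 hf hmin hh.1 hh.2 hR hR1).trans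
      (by linarith))
  obtain ⟨bD, hMD, hmD⟩ := hrun.exists_measure_le_forall_sum_inner_le hf ho hs hΛ1 hexp1 (B := B)
    (u := fun t h => -(adaSGD η γ w₁ h t - wstar))
    (C := fun t => {h | ‖adaSGD η γ w₁ h t - wstar‖ ≤ E}) hB0
    (fun t => (mDist t).neg)
    (fun t h => by rw [adaSGD_pastOf])
    (fun t => measurableSet_dist_le E t)
    (fun t h => by simp only [Set.mem_ofPred_eq, adaSGD_pastOf])
    (fun t h hh => (norm_sub_mul_sqrt_noiseProxy_le hβ hσ₀ hσ₁ hΛ0 hf hmin hh).trans (by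
      have h1 : E * √Λ * σ₀ ≤ E * √Λ * σ₀ * √T :=
        le_mul_of_one_le_right (by positivity) (Real.one_le_sqrt.2 hTR)
      have h2 : 0 ≤ Λ * E ^ 2 * σ₁ ^ 2 * β := by positivity
      have h3 : 0 ≤ E * √Λ * σ₀ := by positivity
      rw [hB]
      linarith))
  set bN := {ω | ∃ t < T, Λ * noiseProxy σ₀ σ₁ f (adaSGD η γ w₁ (fun s => g s ω) t) <
      ‖g t ω - gradient f (adaSGD η γ w₁ (fun s => g s ω) t)‖ ^ 2} with hbN
  -- The total is at most (2T + 12(T + 1))e^{-Λ} ≤ 26·T·e^{-Λ} ≤ 26δ/64.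
  have hbad : μ (bN ∪ (bA ∪ (bB ∪ (bC ∪ bD)))) ≤ ENNReal.ofReal (2 * δ) := by
    have hp : 0 ≤ (T + 1) * (3 * Real.exp (-Λ)) := by positivity
    calc _ ≤ μ bN + (μ bA + (μ bB + (μ bC + μ bD))) :=
          (measure_union_le _ _).trans (add_le_add le_rfl ((measure_union_le _ _).trans
            (add_le_add le_rfl ((measure_union_le _ _).trans
              (add_le_add le_rfl (measure_union_le _ _))))))
      _ ≤ ENNReal.ofReal (T * (2 * Real.exp (-Λ))) + (ENNReal.ofReal ((T + 1) * (3 * Real.exp (-Λ)))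
          + (ENNReal.ofReal ((T + 1) * (3 * Real.exp (-Λ))) +
          (ENNReal.ofReal ((T + 1) * (3 * Real.exp (-Λ))) +
          ENNReal.ofReal ((T + 1) * (3 * Real.exp (-Λ)))))) := by gcongr
      _ ≤ ENNReal.ofReal (2 * δ) := by
          rw [← ENNReal.ofReal_add hp hp, ← ENNReal.ofReal_add hp (by positivity),
            ← ENNReal.ofReal_add hp (by positivity), ← ENNReal.ofReal_add (by positivity)
              (by positivity)]
          apply ENNReal.ofReal_le_ofReal
          have h1 : Real.exp (-Λ) ≤ T * Real.exp (-Λ) :=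
            le_mul_of_one_le_left (Real.exp_pos _).le hTR
          linarith
  refine one_sub_le_measureReal_of_forall_notMem (by linarith) hbad fun ω hω => ?_
  simp only [Set.mem_union, not_or] at hω
  obtain ⟨hNω, hAω, hBω, hCω, hDω⟩ := hω
  have hnoise : ∀ t < T, ‖g t ω - gradient f (adaSGD η γ w₁ (fun s => g s ω) t)‖ ^ 2 ≤
      Λ * noiseProxy σ₀ σ₁ f (adaSGD η γ w₁ (fun s => g s ω) t) := fun t ht =>
    not_lt.1 fun h => hNω ⟨t, ht, h⟩
  -- From here on one good trajectory is fixed and no probability is involved.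
  obtain ⟨G, hG⟩ : ∃ G : ℕ → Vec d, G = fun s => g s ω := ⟨_, rfl⟩
  have hGt : ∀ t, g t ω = G t := fun t => by rw [hG]
  replace hmA := hmA ω hAω hnoise
  replace hmB := hmB ω hBω hnoise
  replace hmC := hmC ω hCω hnoise
  replace hmD := hmD ω hDω hnoise T le_rfl
  simp only [hGt, Set.mem_inter_iff, Set.mem_ofPred_eq] at hmA hmB hmC hmD hnoise
  have hw : ∀ t, adaSGD η γ w₁ G (t + 1) =
      adaSGD η γ w₁ G t - (η / √(sqSum γ G (t + 1))) • G t := fun t => rfl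
  have hlog : ∀ n ≤ T, ∑ t ∈ Finset.range n, ‖G t‖ ^ 2 / sqSum γ G (t + 1) ≤ 7 * L := by
    intro n hn
    refine (sum_sq_div_sqSum_le hγ n).trans ?_
    rw [hL]
    exact log_div_le_of_le hβ hγ hΔ hT hδ hδ4 hΛ (sq_le_sqSum n)
      (sqSum_le_of_noise hβ hη hγ hΛ0 hf hmin hw hnoise hn)
  have hgap := sub_le_gapBound_of_martingale hβ hη hγ hΛ0 hf hmin hw hnoise hlog hN.ge hmA
    (gap_bound_closes hβ hσ₀ hη hL1 (by linarith) hlgL hΔ hF)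
  have hdist := norm_sub_le_of_martingale hβ hη hγ hΛ1 hc hf hmin (by linarith) hw hnoise hlog
    hgap hE0 hR hmB hmC hE2.ge
  have hsum := sum_gap_le_of_martingale hβ hη hγ hΛ0 hc hf hmin hσ₀ hσ₁ hw hnoise hE0 hdist hB
    (hmD fun t ht => hdist t ht.le)
  rw [Set.mem_ofPred_eq, ← hG]
  exact ⟨(map_average_sub_le hc hT _ _).trans (average_bound_le hβ hσ₀ hη hγ (by linarith) hlg1
    hlδ hD0 hE0 hED hB hsum), fun t ht => (hdist t ht).trans hEleD⟩
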